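/- **Setting.** For a real polynomial matrix $G(\xi)$ write $G(\frac{d}{dt})$ for the associated differential operator and $\ker G(\frac{d}{dt})=\{w\in C^\infty(\mathbb R,\mathbb R^{q})\mid G(\frac{d}{dt})w=0\}$. A switched linear differential system (SLDS) $\Sigma$ consists of modes $\mathfrak B_1,\dots,\mathfrak B_N$ of this form, and, for $k\ne\ell$, gluing conditions $(G^-_{k\to\ell},G^+_{k\to\ell})$, two real polynomial matrices with $q$ columns and equally many rows. A switching signal is a right-continuous, piecewise constant $s:\mathbb R\to\{1,\dots,N\}$; its set of switching instants $\mathbb T_s=\{t\mid \lim_{\tau\nearrow t}s(\tau)\neq s(t)\}$ has finitely many elements in each bounded interval. The behaviour $\mathfrak B^s$ is the set of $w:\mathbb R\to\mathbb R^{q}$ that coincide with a trajectory of $\mathfrak B_k$ on each interval on which $s\equiv k$, and that satisfy $G^+_{k\to\ell}(\frac{d}{dt})w(t^+)=G^-_{k\to\ell}(\frac{d}{dt})w(t^-)$ for each $t\in\mathbb T_s$, where $k=s(t^-)$, $\ell=s(t)$; and $\mathfrak B^\Sigma=\bigcup_s\mathfrak B^s$. A set of trajectories (and likewise $\Sigma$,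 through $\mathfrak B^\Sigma$) is asymptotically stable if all its elements tend to $0$ as $t\to\infty$. A two-variable polynomial matrix $\Psi(\zeta,\eta)=\sum_{h,j}\Psi_{h,j}\zeta^h\eta^j$ induces the quadratic differential form $Q_\Psi(w)=\sum_{h,j}(w^{(h)})^\top\Psi_{h,j}w^{(j)}$. The family $\Psi_1,\dots,\Psi_N$ induces a multiple Lyapunov function (MLF) for $\Sigma$ if (1) $Q_{\Psi_k}(w)\ge 0$ for all $w\in\mathfrak B_k$ and all $k$; (2) $\frac{d}{dt}Q_{\Psi_k}$ is negative along $\mathfrak B_k$ for all $k$, i.e. for $w\in\mathfrak B_k$ it is $\le 0$, and it vanishes identically only if $w=0$; (3) for every switching signal $s$, $w\in\mathfrak B^s$ and $t\in\mathbb T_s$ one has $Q_{\Psi_{s(t^-)}}(w)(t^-)\ge Q_{\Psi_{s(t)}}(w)(t^+)$. **Theorem.** Let $\Sigma$ be an SLDS with $\mathfrak B_k=\ker R_k(\frac{d}{dt})$ asymptotically stable and $R_k\in\mathbb R^{q\times q}[\xi]$, $\det R_k\ne0$, $k=1,\dots,N$. Let $n_k=\deg\det R_k$ and let $X_k\in\mathbb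 R^{n_k\times q}[\xi]$ be a minimal state map for $\mathfrak B_k$, i.e. the rows of $X_k$ are a basis of the real vector space of those $f\in\mathbb R^{1\times q}[\xi]$ for which $fR_k^{-1}$ is strictly proper. Write $R_k(\xi)=\sum_{i=0}^{d_k}R_{k,i}\xi^i$ and $X_k(\xi)=\sum_{i=0}^{d_k-1}X_{k,i}\xi^i$, and put $\widetilde R_k=[R_{k,0}\ \cdots\ R_{k,d_k}]$, $\widetilde X_k=[X_{k,0}\ \cdots\ X_{k,d_k-1}]$. Let $\lambda_{k,1},\dots,\lambda_{k,n_k}$ be the complex roots of $\det R_k$ listed with multiplicity, and assume that the algebraic multiplicity of each $\lambda_{k,i}$ equals $\dim\ker R_k(\lambda_{k,i})$. Let $w_{k,i}\in\mathbb C^{q}$ satisfy $R_k(\lambda_{k,i})w_{k,i}=0$, with the $w_{k,i}$ belonging to equal $\lambda_{k,i}$ linearly independent, and let $V_k\in\mathbb C^{n_k\times n_k}$ have columns $X_k(\lambda_{k,i})w_{k,i}$. For $k\ne\ell$ let $F^-_{k\to\ell},F^+_{k\to\ell}$ be the constant real matrices with $G^-_{k\to\ell}\bmod R_k=F^-_{k\to\ell}X_k$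 and $G^+_{k\to\ell}\bmod R_\ell=F^+_{k\to\ell}X_\ell$, where $G\bmod R$ is the unique $G'$ such that $G'R^{-1}$ is strictly proper and $(G-G')R^{-1}$ is polynomial. Assume that the gluing conditions are well-posed: for every $v\in\mathbb R^{n_k}$ there is at most one $u\in\mathbb R^{n_\ell}$ with $F^-_{k\to\ell}v=F^+_{k\to\ell}u$. Fix re-initialisation maps $L_{k\to\ell}=F^{+*}_{k\to\ell}F^-_{k\to\ell}$, with $F^{+*}_{k\to\ell}$ a left inverse of $F^+_{k\to\ell}$. Suppose that $\overline K_k\in\mathbb R^{n_k\times n_k}$ and $\overline Y_k\in\mathbb R^{q\times n_k}$ are such that, for $k=1,\dots,N$, $$\widetilde\Phi_k:=\begin{bmatrix}0\\ \widetilde X_k^\top\end{bmatrix}\overline K_k\begin{bmatrix}\widetilde X_k&0\end{bmatrix}+\begin{bmatrix}\widetilde X_k^\top\\0\end{bmatrix}\overline K_k\begin{bmatrix}0&\widetilde X_k\end{bmatrix}-\begin{bmatrix}\widetilde X_k^\top\\0\end{bmatrix}\overline Y_k^\top\widetilde R_k-\widetilde R_k^\top\overline Y_k\begin{bmatrix}\widetilde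 X_k&0\end{bmatrix}\le 0,$$ where $\le0$ means symmetric and negative semidefinite (and likewise for the inequalities below). Then there exist $\overline F_k\in\mathbb R^{n_k\times n_k}$ such that $$\widetilde\Phi_k=\begin{bmatrix}\widetilde X_k^\top\\0\end{bmatrix}\overline F_k\begin{bmatrix}\widetilde X_k&0\end{bmatrix},\qquad k=1,\dots,N.$$ Moreover, if $\overline F_k<0$ for all $k=1,\dots,N$ and $$V_k^*\overline K_kV_k\ \ge\ V_k^*L_{k\to\ell}^\top\overline K_\ell L_{k\to\ell}V_k\qquad\text{for all }k\neq\ell,$$ then $\Sigma$ is asymptotically stable and $\{X_k(\zeta)^\top\overline K_kX_k(\eta)\}_{k=1,\dots,N}$ induces an MLF for $\Sigma$. -/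

import Mathlib

open Filter Topology
open scoped Matrix ContDiff ComplexOrder

noncomputable section

namespace SwitchedLDS

/-! Linear differential behaviours -/

/-- The function `G(d/dt) w`, for a real polynomial matrix `G` acting on a vector-valued `w`. -/
def polyDiff {g q : ℕ} (G : Matrix (Fin g) (Fin q) (Polynomial ℝ)) (w : ℝ → Fin q → ℝ) :
    ℝ → Fin g → ℝ :=
  fun t i => ∑ j, (G i j).sum fun h a => a * iteratedDeriv h w t j

/-- The behaviour `ker R(d/dt)`: the smooth solutions of `R(d/dt) w = 0`. -/
def kerBehaviour {g q : ℕ} (R : Matrix (Fin g) (Fin q) (Polynomial ℝ)) :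
    Set (ℝ → Fin q → ℝ) :=
  {w | ContDiff ℝ ∞ w ∧ ∀ t, polyDiff R w t = 0}

/-- Linear time-invariant differential behaviours with `q` variables. -/
def IsLinearDifferentialBehaviour {q : ℕ} (B : Set (ℝ → Fin q → ℝ)) : Prop :=
  ∃ (g : ℕ) (R : Matrix (Fin g) (Fin q) (Polynomial ℝ)), B = kerBehaviour R

/-- All trajectories of the set `B` tend to `0` at `+∞`. -/
def AsymptoticallyStable {q : ℕ} (B : Set (ℝ → Fin q → ℝ)) : Prop :=
  ∀ w ∈ B, Tendsto w atTop (𝓝 0)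

/-! Canonical representatives and state maps -/

/-- A rational function is strictly proper if its numerator has smaller degree than its
denominator; this includes the zero function, as `degree 0 = ⊥`. -/
def IsStrictlyProper (r : RatFunc ℝ) : Prop :=
  r.num.degree < r.denom.degree

/-- The set of polynomial row vectors `f` such that `f R⁻¹` is strictly proper. -/
def stateSpace {q : ℕ} (R : Matrix (Fin q) (Fin q) (Polynomial ℝ)) :
    Set (Fin q → Polynomial ℝ) :=
  {f | ∀ j, IsStrictlyProper
    (((fun i => algebraMap (Polynomial ℝ) (RatFunc ℝ) (f i)) ᵥ*
      (R.map (algebraMap (Polynomial ℝ) (RatFunc ℝ)))⁻¹) j)}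

/-- `X` is a minimal state map for `ker R(d/dt)`: its rows form a basis of the real vector
space of the row vectors `f` with `f R⁻¹` strictly proper. -/
def IsMinimalStateMap {n q : ℕ} (R : Matrix (Fin q) (Fin q) (Polynomial ℝ))
    (X : Matrix (Fin n) (Fin q) (Polynomial ℝ)) : Prop :=
  LinearIndependent ℝ X.row ∧
    (Submodule.span ℝ (Set.range X.row) : Set (Fin q → Polynomial ℝ)) = stateSpace R

/-- `G' = G mod R`: `G' R⁻¹` is strictly proper and `(G - G') R⁻¹` is polynomial. -/
def IsCanonicalRepresentative {g q : ℕ} (R : Matrix (Fin q) (Fin q) (Polynomial ℝ))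
    (G G' : Matrix (Fin g) (Fin q) (Polynomial ℝ)) : Prop :=
  (∀ i, G'.row i ∈ stateSpace R) ∧
    ∃ P : Matrix (Fin g) (Fin q) (Polynomial ℝ), G = G' + P * R

/-! Switching signals and switched linear differential systems -/

/-- The switching instants of `s`: the `t` for which `s(τ) → s(t)` as `τ ↗ t` fails. -/
def switchingInstants {N : ℕ} (s : ℝ → Fin N) : Set ℝ :=
  {t | ¬ Tendsto s (𝓝[<] t) (𝓝 (s t))}

/-- Admissible switching signals: right-continuous (for the discrete topology on the indices)
with finitely many switching instants in each bounded interval. Such a signal is constant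
between consecutive switching instants. -/
structure IsSwitchingSignal {N : ℕ} (s : ℝ → Fin N) : Prop where
  rightContinuous : ∀ t, Tendsto s (𝓝[≥] t) (𝓝 (s t))
  locallyFinite : ∀ a b : ℝ, (switchingInstants s ∩ Set.Icc a b).Finite

/-- A switched linear differential system with `N` modes and `q` variables. The gluing conditions
are used only for pairs of distinct indices. -/
structure SLDS (N q : ℕ) where
  mode : Fin N → Set (ℝ → Fin q → ℝ)
  mode_isLinear : ∀ k, IsLinearDifferentialBehaviour (mode k)
  gluingRows : Fin N → Fin N → ℕ
  gluingMinus : ∀ k l, Matrix (Fin (gluingRows k l)) (Fin q) (Polynomial ℝ)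
  gluingPlus : ∀ k l, Matrix (Fin (gluingRows k l)) (Fin q) (Polynomial ℝ)

/-- The `s`-switched behaviour. On every interval where `s` is constantly `k` the trajectory is
the restriction of an element of the `k`-th mode, and at a switching instant `t` from `k = s(t⁻)`
to `s(t)` the one-sided limits `G⁺(d/dt) w (t⁺)` and `G⁻(d/dt) w (t⁻)` agree. -/
def SLDS.signalBehaviour {N q : ℕ} (S : SLDS N q) (s : ℝ → Fin N) : Set (ℝ → Fin q → ℝ) :=
  {w | (∀ (k : Fin N) (I : Set ℝ), I.OrdConnected → (∀ t ∈ I, s t = k) →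
          ∃ v ∈ S.mode k, Set.EqOn w v I) ∧
       (∀ t ∈ switchingInstants s, ∀ k, Tendsto s (𝓝[<] t) (𝓝 k) →
          ∃ c : Fin (S.gluingRows k (s t)) → ℝ,
            Tendsto (polyDiff (S.gluingPlus k (s t)) w) (𝓝[>] t) (𝓝 c) ∧
            Tendsto (polyDiff (S.gluingMinus k (s t)) w) (𝓝[<] t) (𝓝 c))}

/-- The switched behaviour: the union over all admissible switching signals. -/
def SLDS.behaviour {N q : ℕ} (S : SLDS N q) : Set (ℝ → Fin q → ℝ) :=
  {w | ∃ s, IsSwitchingSignal s ∧ w ∈ S.signalBehaviour s}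

/-! Normal form of the gluing conditions, well-posedness, re-initialisation maps -/

/-- The constant matrices `Fm k l`, `Fp k l` give the normal form of the gluing conditions:
`G⁻ mod R_k = F⁻ X_k` and `G⁺ mod R_l = F⁺ X_l` for each transition `k → l`. -/
def IsNormalForm {N q : ℕ} (S : SLDS N q) {n : Fin N → ℕ}
    (R : Fin N → Matrix (Fin q) (Fin q) (Polynomial ℝ))
    (X : ∀ k, Matrix (Fin (n k)) (Fin q) (Polynomial ℝ))
    (Fm : ∀ k l, Matrix (Fin (S.gluingRows k l)) (Fin (n k)) ℝ)
    (Fp : ∀ k l, Matrix (Fin (S.gluingRows k l)) (Fin (n l)) ℝ) : Prop :=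
  ∀ k l, k ≠ l →
    IsCanonicalRepresentative (R k) (S.gluingMinus k l) ((Fm k l).map Polynomial.C * X k) ∧
    IsCanonicalRepresentative (R l) (S.gluingPlus k l) ((Fp k l).map Polynomial.C * X l)

/-- Well-posedness: a final state `v` admits at most one compatible initial state. -/
def IsWellPosed {N : ℕ} {n : Fin N → ℕ} {g : Fin N → Fin N → ℕ}
    (Fm : ∀ k l, Matrix (Fin (g k l)) (Fin (n k)) ℝ)
    (Fp : ∀ k l, Matrix (Fin (g k l)) (Fin (n l)) ℝ) : Prop :=
  ∀ k l, k ≠ l → ∀ (v : Fin (n k) → ℝ) (u u' : Fin (n l) → ℝ),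
    Fm k l *ᵥ v = Fp k l *ᵥ u → Fm k l *ᵥ v = Fp k l *ᵥ u' → u = u'

/-- `L` is a re-initialisation map: `L = M F⁻` with `M` a left inverse of `F⁺`. -/
def IsReinitialisationMap {g m n : ℕ} (Fm : Matrix (Fin g) (Fin m) ℝ)
    (Fp : Matrix (Fin g) (Fin n) ℝ) (L : Matrix (Fin n) (Fin m) ℝ) : Prop :=
  ∃ M : Matrix (Fin n) (Fin g) ℝ, M * Fp = 1 ∧ L = M * Fm

/-! Quadratic differential forms and multiple Lyapunov functions -/

/-- The quadratic differential form of a two-variable polynomial matrix, the variables `0` and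
`1` being `ζ` and `η`: the sum over `h, k` of `(w^(h))ᵀ Φ_{h,k} w^(k)`. -/
def qdf {q : ℕ} (Φ : Matrix (Fin q) (Fin q) (MvPolynomial (Fin 2) ℝ)) (w : ℝ → Fin q → ℝ) :
    ℝ → ℝ :=
  fun t => ∑ i, ∑ j, ∑ m ∈ (Φ i j).support,
    iteratedDeriv (m 0) w t i * (Φ i j).coeff m * iteratedDeriv (m 1) w t j

/-- The polynomial matrix `X` with its variable replaced by the two-variable indeterminate `v`. -/
def inVariable {n q : ℕ} (v : Fin 2) (X : Matrix (Fin n) (Fin q) (Polynomial ℝ)) :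
    Matrix (Fin n) (Fin q) (MvPolynomial (Fin 2) ℝ) :=
  X.map (Polynomial.aeval (MvPolynomial.X v))

/-- The two-variable polynomial matrix `X(ζ)ᵀ K X(η)`. -/
def quadraticForm {n q : ℕ} (X : Matrix (Fin n) (Fin q) (Polynomial ℝ))
    (K : Matrix (Fin n) (Fin n) ℝ) : Matrix (Fin q) (Fin q) (MvPolynomial (Fin 2) ℝ) :=
  (inVariable 0 X)ᵀ * (K.map MvPolynomial.C : Matrix (Fin n) (Fin n) (MvPolynomial (Fin 2) ℝ)) *
    inVariable 1 X

/-- The functional `Q` is nonnegative along `B`. -/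
def NonnegAlong {q : ℕ} (B : Set (ℝ → Fin q → ℝ)) (Q : (ℝ → Fin q → ℝ) → ℝ → ℝ) : Prop :=
  ∀ w ∈ B, ∀ t, 0 ≤ Q w t

/-- The functional `Q` is negative along `B`: it is nonpositive along `B`, and vanishes
identically on no nonzero trajectory of `B`. -/
def NegAlong {q : ℕ} (B : Set (ℝ → Fin q → ℝ)) (Q : (ℝ → Fin q → ℝ) → ℝ → ℝ) : Prop :=
  (∀ w ∈ B, ∀ t, Q w t ≤ 0) ∧ ∀ w ∈ B, (∀ t, Q w t = 0) → w = 0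

/-- The forms `Q_{Ψ_k}` are a multiple Lyapunov function: each is nonnegative with negative
derivative along its mode, and the value does not increase at the switching instants. -/
structure IsMultipleLyapunovFunction {N q : ℕ} (S : SLDS N q)
    (Ψ : Fin N → Matrix (Fin q) (Fin q) (MvPolynomial (Fin 2) ℝ)) : Prop where
  nonneg : ∀ k, NonnegAlong (S.mode k) (qdf (Ψ k))
  deriv_neg : ∀ k, NegAlong (S.mode k) (fun w => deriv (qdf (Ψ k) w))
  jump : ∀ s, IsSwitchingSignal s → ∀ w ∈ S.signalBehaviour s,
    ∀ t ∈ switchingInstants s, ∀ k, Tendsto s (𝓝[<] t) (𝓝 k) →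
      ∃ a b : ℝ, Tendsto (qdf (Ψ k) w) (𝓝[<] t) (𝓝 a) ∧
        Tendsto (qdf (Ψ (s t)) w) (𝓝[>] t) (𝓝 b) ∧ b ≤ a

/-! Coefficient matrices and the structured matrix of the linear matrix inequality -/

/-- The coefficient matrix `[P_0 ... P_{d-1}]` of a polynomial matrix. -/
def coeffMatrix {m q : ℕ} (d : ℕ) (P : Matrix (Fin m) (Fin q) (Polynomial ℝ)) :
    Matrix (Fin m) (Fin d × Fin q) ℝ :=
  Matrix.of fun a p => (P a p.2).coeff p.1

/-- The block matrix `[A 0]`, with a zero block of width `q` on the right. -/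
def padRight {m d q : ℕ} (A : Matrix (Fin m) (Fin d × Fin q) ℝ) :
    Matrix (Fin m) (Fin (d + 1) × Fin q) ℝ :=
  Matrix.of fun a p => Fin.lastCases (motive := fun _ => ℝ) 0 (fun i => A a (i, p.2)) p.1

/-- The block matrix `[0 A]`, with a zero block of width `q` on the left. -/
def padLeft {m d q : ℕ} (A : Matrix (Fin m) (Fin d × Fin q) ℝ) :
    Matrix (Fin m) (Fin (d + 1) × Fin q) ℝ :=
  Matrix.of fun a p => Fin.cases (motive := fun _ => ℝ) 0 (fun i => A a (i, p.2)) p.1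

/-- The matrix `[0; X̃ᵀ] K [X̃ 0] + [X̃ᵀ; 0] K [0 X̃] - [X̃ᵀ; 0] Yᵀ R̃ - R̃ᵀ Y [X̃ 0]`, where `R̃`
has the coefficients of `R` of degree at most `d` and `X̃` those of `X` of degree less than `d`. -/
def lmiMatrix {n q : ℕ} (d : ℕ) (R : Matrix (Fin q) (Fin q) (Polynomial ℝ))
    (X : Matrix (Fin n) (Fin q) (Polynomial ℝ))
    (K : Matrix (Fin n) (Fin n) ℝ) (Y : Matrix (Fin q) (Fin n) ℝ) :
    Matrix (Fin (d + 1) × Fin q) (Fin (d + 1) × Fin q) ℝ :=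
  (padLeft (coeffMatrix d X))ᵀ * K * padRight (coeffMatrix d X)
    + (padRight (coeffMatrix d X))ᵀ * K * padLeft (coeffMatrix d X)
    - (padRight (coeffMatrix d X))ᵀ * Yᵀ * coeffMatrix (d + 1) R
    - (coeffMatrix (d + 1) R)ᵀ * Y * padRight (coeffMatrix d X)

/-- The value at `z : ℂ` of a real polynomial matrix. -/
def evalAt {m q : ℕ} (P : Matrix (Fin m) (Fin q) (Polynomial ℝ)) (z : ℂ) :
    Matrix (Fin m) (Fin q) ℂ :=
  P.map (Polynomial.aeval z)

/-- A real matrix viewed as a complex matrix. -/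
def toComplex {m n : ℕ} (A : Matrix (Fin m) (Fin n) ℝ) : Matrix (Fin m) (Fin n) ℂ :=
  A.map Complex.ofReal

/-- The matrix with columns `X(z_i) w_i`. -/
def modalMatrix {n q : ℕ} (X : Matrix (Fin n) (Fin q) (Polynomial ℝ)) (z : Fin n → ℂ)
    (w : Fin n → Fin q → ℂ) : Matrix (Fin n) (Fin n) ℂ :=
  Matrix.of fun a i => (evalAt X (z i) *ᵥ w i) a

end SwitchedLDS

end

/-!
Along `ker R(d/dt)` the state `x = X(d/dt) w` determines every polynomial differential expression
in `w` by a constant matrix, since every polynomial matrix is a constant multiple of `X` modulo `R`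
(`IsMinimalStateMap.exists_eq`). In particular `w = C x`, and the form induced by `X(ζ)ᵀ K X(η)`
takes the value `xᵀ K x`.

*Factorisation.* Let the structured matrix be `-DᵀD`, and let `D(ξ)` be the polynomial matrix with
coefficient matrix `D`. For `ζ = -ξ`, `η = ξ` the two-variable polynomial matrix loses its terms
in `K`, so that `D(-ξ)ᵀ D(ξ) = X(-ξ)ᵀ Yᵀ R(ξ) + R(-ξ)ᵀ Y X(ξ)`. Multiplication by `adj R` on both
sides shows that the diagonal entries of `(D adj R)(-ξ)ᵀ (D adj R)(ξ)` have degree less than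
`2 deg det R`. The leading terms in such a sum of squares do not cancel
(`degree_lt_of_sum_comp_neg_mul`), so `D R⁻¹` is strictly proper, `D = B [X̃ 0]` for a constant
matrix `B`, and `F = -BᵀB` is as required (`exists_lmiMatrix_eq`).

*Each mode.* Contraction of the structured matrix with the jet of a trajectory gives
`d/dt (xᵀ K x) = xᵀ F x` (`hasDerivAt_storage`). With `F < 0` and `x → 0` the storage function
`xᵀ K x` is nonnegative, and it vanishes only at `x = 0`; by compactness it dominates `|w|²` and is
dominated by `-xᵀ F x` (`IsStrictStorage.exists_bound`).

*Transitions.* The gluing conditions in normal form give `x⁺ = L x⁻`. The modal matrix is invertible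
(`isUnit_modalMatrix`), so the inequality in modal coordinates says that `xᵀ K x` does not increase
(`storage_jump_le`). For small `α > 0` the function `exp (α t) V(t)`, with `V` the storage function
of the active mode, is therefore nonincreasing across every instant, hence on the whole line, and
`V` and `w` tend to `0` (`asymptoticallyStable_behaviour`).
-/

namespace SwitchedLDS
open Polynomial

/-! ### Strictly proper rows and division by `R` -/

theorem isStrictlyProper_div_iff (p : ℝ[X]) {r : ℝ[X]} (hr : r ≠ 0) :
    IsStrictlyProper (algebraMap ℝ[X] (RatFunc ℝ) p / algebraMap ℝ[X] (RatFunc ℝ) r) ↔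
      p.degree < r.degree := by
  set x := algebraMap ℝ[X] (RatFunc ℝ) p / algebraMap ℝ[X] (RatFunc ℝ) r with hx
  have h : x.num * r = p * x.denom := (RatFunc.num_mul_eq_mul_denom_iff hr).2 hx
  have hd := congrArg Polynomial.degree h
  rw [Polynomial.degree_mul, Polynomial.degree_mul] at hd
  unfold IsStrictlyProper
  have hx0 := RatFunc.denom_ne_zero x
  rw [Polynomial.degree_eq_natDegree hx0, Polynomial.degree_eq_natDegree hr] at *
  rcases hn : x.num.degree with _ | a <;> rcases hp : p.degree with _ | b <;>
    simp only [hn, hp] at hd ⊢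
  · exact ⟨fun _ => WithBot.bot_lt_coe _, fun _ => WithBot.bot_lt_coe _⟩
  · exact absurd hd (by
      change (⊥ : WithBot ℕ) + _ ≠ ((b : ℕ) : WithBot ℕ) + _
      rw [WithBot.bot_add]; norm_cast)
  · exact absurd hd (by
      change ((a : ℕ) : WithBot ℕ) + _ ≠ (⊥ : WithBot ℕ) + _
      rw [WithBot.bot_add]; norm_cast)
  · change ((a : ℕ) : WithBot ℕ) + _ = ((b : ℕ) : WithBot ℕ) + _ at hd
    change ((a : ℕ) : WithBot ℕ) < _ ↔ ((b : ℕ) : WithBot ℕ) < _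
    norm_cast at *
    omega

/-- By Cramer's rule, strict properness of `f R⁻¹` is a degree condition on `f adj R`. -/
theorem mem_stateSpace_iff {q : ℕ} {R : Matrix (Fin q) (Fin q) ℝ[X]} (hR : R.det ≠ 0)
    (f : Fin q → ℝ[X]) :
    f ∈ stateSpace R ↔ ∀ j, ((f ᵥ* R.adjugate) j).degree < R.det.degree := by
  unfold stateSpace
  refine forall_congr' fun j => ?_
  rw [← isStrictlyProper_div_iff _ hR]
  have h1 : (R.map (algebraMap ℝ[X] (RatFunc ℝ)))⁻¹ =
      (algebraMap ℝ[X] (RatFunc ℝ) R.det)⁻¹ •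
        R.adjugate.map (algebraMap ℝ[X] (RatFunc ℝ)) := by
    rw [Matrix.inv_def, Ring.inverse_eq_inv']
    congr 1
    · rw [RingHom.map_det]; rfl
    · exact (RingHom.map_adjugate (algebraMap ℝ[X] (RatFunc ℝ)) R).symm
  rw [h1, Matrix.vecMul_smul, Pi.smul_apply, smul_eq_mul, div_eq_inv_mul]
  congr! 2
  simp [Matrix.vecMul, dotProduct, map_sum]

/-- A row with `f R⁻¹` strictly proper has smaller degree than `R`. -/
theorem degree_lt_of_mem_stateSpace {q : ℕ} {R : Matrix (Fin q) (Fin q) ℝ[X]} (hR : R.det ≠ 0)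
    {d : ℕ} (hd : ∀ i j, (R i j).natDegree ≤ d) {f : Fin q → ℝ[X]} (hf : f ∈ stateSpace R)
    (j : Fin q) : (f j).degree < d := by
  rw [mem_stateSpace_iff hR] at hf
  have h : f j * R.det = ∑ i, (f ᵥ* R.adjugate) i * R i j := by
    have : (f ᵥ* R.adjugate) ᵥ* R = R.det • f := by
      rw [Matrix.vecMul_vecMul, Matrix.adjugate_mul, Matrix.vecMul_smul, Matrix.vecMul_one]
    have := congrFun this j
    simp only [Pi.smul_apply, smul_eq_mul] at this
    rw [mul_comm, ← this]; rfl
  have hdeg : (f j * R.det).degree < R.det.degree + d := by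
    rw [h]
    refine lt_of_le_of_lt (Polynomial.degree_sum_le _ _) ?_
    rw [Finset.sup_lt_iff (by
      rw [Polynomial.degree_eq_natDegree hR]; norm_cast; exact WithBot.bot_lt_coe _)]
    intro i _
    rw [Polynomial.degree_mul]
    have h1 := hf i
    have h2 : (R i j).degree ≤ d := Polynomial.natDegree_le_iff_degree_le.1 (hd i j)
    calc _ ≤ ((f ᵥ* R.adjugate) i).degree + (d : WithBot ℕ) := by gcongr
      _ < _ := WithBot.add_lt_add_right (WithBot.natCast_ne_bot d) h1
  rw [Polynomial.degree_mul, add_comm] at hdeg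
  exact lt_of_add_lt_add_left hdeg

/-- Division with remainder by a nonsingular polynomial matrix. -/
theorem exists_sub_vecMul_mem_stateSpace {q : ℕ} {R : Matrix (Fin q) (Fin q) ℝ[X]}
    (hR : R.det ≠ 0) (g : Fin q → ℝ[X]) : ∃ p, g - p ᵥ* R ∈ stateSpace R := by
  refine ⟨fun j => (g ᵥ* R.adjugate) j / R.det, ?_⟩
  rw [mem_stateSpace_iff hR]
  intro j
  rw [Matrix.sub_vecMul, Matrix.vecMul_vecMul, Matrix.mul_adjugate, Matrix.vecMul_smul,
    Matrix.vecMul_one, Pi.sub_apply, Pi.smul_apply, smul_eq_mul]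
  have := EuclideanDomain.mod_eq_sub_mul_div ((g ᵥ* R.adjugate) j) R.det
  rw [← this]
  exact EuclideanDomain.mod_lt _ hR

theorem IsMinimalStateMap.exists_vecMul {n q : ℕ} {R : Matrix (Fin q) (Fin q) ℝ[X]}
    {X : Matrix (Fin n) (Fin q) ℝ[X]} (hX : IsMinimalStateMap R X) {f : Fin q → ℝ[X]}
    (hf : f ∈ stateSpace R) : ∃ a : Fin n → ℝ, f = (fun i => C (a i)) ᵥ* X := by
  rw [← hX.2, SetLike.mem_coe, Submodule.mem_span_range_iff_exists_fun] at hf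
  obtain ⟨a, ha⟩ := hf
  refine ⟨a, ?_⟩
  rw [← ha]
  ext1 j
  simp [Matrix.vecMul, dotProduct, Polynomial.smul_eq_C_mul]

/-- Modulo the rows of `R`, every polynomial matrix is a constant multiple of the state map. -/
theorem IsMinimalStateMap.exists_eq {m n q : ℕ} {R : Matrix (Fin q) (Fin q) ℝ[X]}
    {X : Matrix (Fin n) (Fin q) ℝ[X]} (hX : IsMinimalStateMap R X) (hR : R.det ≠ 0)
    (G : Matrix (Fin m) (Fin q) ℝ[X]) :
    ∃ (A : Matrix (Fin m) (Fin n) ℝ) (P : Matrix (Fin m) (Fin q) ℝ[X]),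
      G = A.map C * X + P * R := by
  choose P hP using fun i => exists_sub_vecMul_mem_stateSpace hR (G i)
  choose A hA using fun i => hX.exists_vecMul (hP i)
  refine ⟨Matrix.of A, Matrix.of P, ?_⟩
  ext1 i j
  have := congrFun (hA i) j
  rw [Pi.sub_apply, sub_eq_iff_eq_add] at this
  rw [this]; rfl

theorem IsMinimalStateMap.row_mem {n q : ℕ} {R : Matrix (Fin q) (Fin q) ℝ[X]}
    {X : Matrix (Fin n) (Fin q) ℝ[X]} (hX : IsMinimalStateMap R X) (i : Fin n) :
    X i ∈ stateSpace R := by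
  rw [← hX.2]
  exact Submodule.subset_span ⟨i, rfl⟩

/-! ### Spectral factors of the linear matrix inequality -/

/-- In `∑ p_a(-ξ) p_a(ξ)` the leading terms of the `p_a` of maximal degree add up with the same
sign, so they cannot cancel. -/
theorem degree_lt_of_sum_comp_neg_mul {ι : Type*} [Fintype ι] (p : ι → ℝ[X]) (N : ℕ)
    (h : (∑ a, (p a).comp (-X) * p a).degree < ((2 * N : ℕ) : WithBot ℕ)) (a : ι) :
    (p a).degree < N := by
  by_contra ha
  rw [not_lt] at ha
  obtain ⟨b, -, hb⟩ := Finset.exists_max_image Finset.univ (fun a => (p a).degree)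
    ⟨a, Finset.mem_univ a⟩
  have hbN : (N : WithBot ℕ) ≤ (p b).degree := ha.trans (hb a (Finset.mem_univ a))
  have hb0 : p b ≠ 0 := by
    rintro h0
    rw [h0, Polynomial.degree_zero] at hbN
    exact absurd hbN (not_le.2 (WithBot.bot_lt_coe _))
  set M := (p b).natDegree with hM
  have hNM : N ≤ M := by
    rw [Polynomial.degree_eq_natDegree hb0] at hbN
    exact_mod_cast hbN
  have hle : ∀ c, (p c).natDegree ≤ M := fun c =>
    Polynomial.natDegree_le_natDegree (hb c (Finset.mem_univ c))
  have hcomp : ∀ c, ((p c).comp (-X)).natDegree ≤ M := fun c => by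
    refine Polynomial.natDegree_comp_le.trans ?_
    simpa using hle c
  have hcoeff : (∑ a, (p a).comp (-X) * p a).coeff (M + M) =
      (-1) ^ M * ∑ a, (p a).coeff M ^ 2 := by
    rw [Polynomial.finsetSum_coeff, Finset.mul_sum]
    refine Finset.sum_congr rfl fun c _ => ?_
    rw [Polynomial.coeff_mul_add_eq_of_natDegree_le (hcomp c) (hle c),
      show (-X : ℝ[X]) = C (-1) * X by simp, Polynomial.comp_C_mul_X_coeff]
    ring
  have hz : (∑ a, (p a).comp (-X) * p a).coeff (M + M) = 0 := by
    refine Polynomial.coeff_eq_zero_of_degree_lt (h.trans_le ?_)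
    exact_mod_cast (by omega : 2 * N ≤ M + M)
  rw [hz] at hcoeff
  have hs : ∑ a, (p a).coeff M ^ 2 = 0 := by
    rcases mul_eq_zero.1 hcoeff.symm with h1 | h1
    · exact absurd h1 (by positivity)
    · exact h1
  have := (Finset.sum_eq_zero_iff_of_nonneg (fun c _ => sq_nonneg _)).1 hs b (Finset.mem_univ b)
  rw [sq_eq_zero_iff] at this
  exact hb0 (Polynomial.leadingCoeff_eq_zero.1 this)

theorem padRight_coeffMatrix {m d q : ℕ} (G : Matrix (Fin m) (Fin q) ℝ[X])
    (hG : ∀ i j, (G i j).degree < d) :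
    padRight (coeffMatrix d G) = coeffMatrix (d + 1) G := by
  ext a ⟨i, j⟩
  refine Fin.lastCases ?_ (fun i => ?_) i
  · simp [padRight, coeffMatrix, Polynomial.coeff_eq_zero_of_degree_lt (hG a j)]
  · simp [padRight, coeffMatrix]

theorem padLeft_coeffMatrix {m d q : ℕ} (G : Matrix (Fin m) (Fin q) ℝ[X]) :
    padLeft (coeffMatrix d G) = coeffMatrix (d + 1) ((X : ℝ[X]) • G) := by
  ext a ⟨i, j⟩
  refine Fin.cases ?_ (fun i => ?_) i
  · simp [padLeft, coeffMatrix]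
  · simp [padLeft, coeffMatrix, Polynomial.coeff_X_mul]

theorem natDegree_X_smul_le {m d q : ℕ} {G : Matrix (Fin m) (Fin q) ℝ[X]}
    (hG : ∀ i j, (G i j).degree < d) (i : Fin m) (j : Fin q) :
    (((X : ℝ[X]) • G) i j).natDegree ≤ d := by
  rw [Matrix.smul_apply, smul_eq_mul]
  by_cases h0 : G i j = 0
  · simp [h0]
  · rw [Polynomial.natDegree_X_mul h0]
    exact (Polynomial.natDegree_lt_iff_degree_lt h0).2 (hG i j)

/-- The block column with blocks `1, ξ, ..., ξ ^ d`. -/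
noncomputable def powerColumn (d q : ℕ) : Matrix (Fin (d + 1) × Fin q) (Fin q) ℝ[X] :=
  Matrix.of fun p j => if p.2 = j then X ^ (p.1 : ℕ) else 0

theorem coeffMatrix_mul_powerColumn {m d q : ℕ} (G : Matrix (Fin m) (Fin q) ℝ[X])
    (hG : ∀ i j, (G i j).natDegree ≤ d) :
    (coeffMatrix (d + 1) G).map C * powerColumn d q = G := by
  ext1 a j
  rw [Matrix.mul_apply, Fintype.sum_prod_type]
  simp only [powerColumn, coeffMatrix, Matrix.map_apply, Matrix.of_apply, mul_ite, mul_zero,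
    Finset.sum_ite_eq', Finset.mem_univ, if_true]
  rw [Fin.sum_univ_eq_sum_range (fun i => C ((G a j).coeff i) * X ^ i)]
  exact ((G a j).as_sum_range_C_mul_X_pow' (Nat.lt_succ_of_le (hG a j))).symm

/-- The substitution `ξ ↦ -ξ`. -/
noncomputable def reflect : ℝ[X] →+* ℝ[X] := Polynomial.compRingHom (-X)

theorem reflect_C (c : ℝ) : reflect (C c) = C c := by simp [reflect]

theorem degree_reflect (f : ℝ[X]) : (reflect f).degree = f.degree := by
  rw [reflect, Polynomial.coe_compRingHom_apply]
  by_cases hf : f = 0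
  · simp [hf]
  · have h0 : f.comp (-X) ≠ 0 := by
      rw [← Polynomial.leadingCoeff_ne_zero, Polynomial.comp_neg_X_leadingCoeff_eq]
      exact mul_ne_zero (by simp) (Polynomial.leadingCoeff_ne_zero.2 hf)
    rw [Polynomial.degree_eq_natDegree hf, Polynomial.degree_eq_natDegree h0,
      Polynomial.natDegree_comp]
    simp

theorem map_reflect_mul {l m n : Type*} [Fintype m] (A : Matrix l m ℝ) (T : Matrix m n ℝ[X]) :
    (A.map C * T).map reflect = A.map C * T.map reflect := by
  rw [Matrix.map_mul, Matrix.map_map]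
  congr 2
  ext1 c
  exact reflect_C c

theorem reflect_transpose_mul_mul {ι m m' n : Type*} [Fintype ι] [Fintype m] [Fintype m']
    (T : Matrix ι n ℝ[X]) (A : Matrix m ι ℝ) (M : Matrix m m' ℝ) (B : Matrix m' ι ℝ) :
    (T.map reflect)ᵀ * (Aᵀ * M * B).map C * T =
      ((A.map C * T).map reflect)ᵀ * M.map C * (B.map C * T) := by
  rw [map_reflect_mul, Matrix.map_mul, Matrix.map_mul, Matrix.transpose_mul, Matrix.transpose_map]
  simp only [Matrix.mul_assoc]

/-- On setting `ζ = -ξ`, `η = ξ` the terms with `K` cancel, since they carry a factor `ζ + η`. -/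
theorem reflect_powerColumn_mul_lmiMatrix {n q d : ℕ} {R : Matrix (Fin q) (Fin q) ℝ[X]}
    (hd : ∀ i j, (R i j).natDegree ≤ d) {X : Matrix (Fin n) (Fin q) ℝ[X]}
    (hdX : ∀ i j, (X i j).degree < d)
    (K : Matrix (Fin n) (Fin n) ℝ) (Y : Matrix (Fin q) (Fin n) ℝ) :
    ((powerColumn d q).map reflect)ᵀ * (lmiMatrix d R X K Y).map C * powerColumn d q =
      -((X.map reflect)ᵀ * (Y.map C)ᵀ * R + (R.map reflect)ᵀ * Y.map C * X) := by
  have hdX' : ∀ i j, (X i j).natDegree ≤ d := fun i j =>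
    Polynomial.natDegree_le_iff_degree_le.2 (hdX i j).le
  have hdX'' := natDegree_X_smul_le hdX
  have hξ : ((Polynomial.X : ℝ[X]) • X).map reflect =
      -((Polynomial.X : ℝ[X]) • X.map reflect) := by
    ext1 i j
    simp [reflect]
  rw [lmiMatrix, padRight_coeffMatrix _ hdX, padLeft_coeffMatrix,
    Matrix.map_sub _ (map_sub C), Matrix.map_sub _ (map_sub C), Matrix.map_add _ (map_add C)]
  simp only [Matrix.mul_sub, Matrix.mul_add, Matrix.sub_mul, Matrix.add_mul,
    reflect_transpose_mul_mul, coeffMatrix_mul_powerColumn _ hd,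
    coeffMatrix_mul_powerColumn _ hdX', coeffMatrix_mul_powerColumn _ hdX'', hξ,
    Matrix.transpose_map]
  simp only [Matrix.transpose_neg, Matrix.transpose_smul, Matrix.neg_mul, Matrix.smul_mul,
    Matrix.mul_smul]
  abel

/-- If the matrix of the inequality is `-DᵀD`, then the rows of `D(ξ)` belong to the state space:
`(D adj R)(-ξ)ᵀ (D adj R)(ξ)` is a sum of two terms, each the product of `det R(±ξ)` and entries
of `X adj R` up to reflection and constants. -/
theorem factor_row_mem_stateSpace {n q d : ℕ} {ι : Type*} [Fintype ι]
    {R : Matrix (Fin q) (Fin q) ℝ[X]} (hR : R.det ≠ 0) (hd : ∀ i j, (R i j).natDegree ≤ d)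
    {X : Matrix (Fin n) (Fin q) ℝ[X]} (hX : IsMinimalStateMap R X)
    {K : Matrix (Fin n) (Fin n) ℝ} {Y : Matrix (Fin q) (Fin n) ℝ}
    {D : Matrix ι (Fin (d + 1) × Fin q) ℝ} (hD : lmiMatrix d R X K Y = -(Dᵀ * D)) (a : ι) :
    (D.map C * powerColumn d q) a ∈ stateSpace R := by
  set T := powerColumn d q with hT
  have hmain : ((D.map C * T).map reflect)ᵀ * (D.map C * T) =
      (X.map reflect)ᵀ * (Y.map C)ᵀ * R + (R.map reflect)ᵀ * Y.map C * X := by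
    have h1 := reflect_powerColumn_mul_lmiMatrix hd
      (fun i j => degree_lt_of_mem_stateSpace hR hd (hX.row_mem i) j) K Y
    rw [hD, Matrix.map_neg _ (map_neg C), Matrix.mul_neg, Matrix.neg_mul, neg_inj] at h1
    rw [← h1, map_reflect_mul, Matrix.map_mul, Matrix.transpose_mul, Matrix.transpose_map]
    simp only [Matrix.mul_assoc, hT]
  obtain ⟨E, hE⟩ : ∃ E, E = X * R.adjugate := ⟨_, rfl⟩
  obtain ⟨G, hG⟩ : ∃ G, G = D.map C * T := ⟨_, rfl⟩
  obtain ⟨p, hp⟩ : ∃ p, p = G * R.adjugate := ⟨_, rfl⟩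
  rw [← hG] at hmain ⊢
  have hEdeg : ∀ i j, (E i j).degree < R.det.degree := fun i j => by
    rw [hE]; exact (mem_stateSpace_iff hR (X i)).1 (hX.row_mem i) j
  have hprod : (p.map reflect)ᵀ * p =
      R.det • ((E.map reflect)ᵀ * (Y.map C)ᵀ) + reflect R.det • (Y.map C * E) := by
    have hadj : (R.adjugate.map reflect)ᵀ * (R.map reflect)ᵀ =
        reflect R.det • (1 : Matrix (Fin q) (Fin q) ℝ[X]) := by
      rw [← Matrix.transpose_mul, ← Matrix.map_mul, Matrix.mul_adjugate]
      ext1 i j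
      by_cases h : i = j
      · subst h; simp
      · simp [h, Ne.symm h]
    calc (p.map reflect)ᵀ * p
        = (R.adjugate.map reflect)ᵀ * ((G.map reflect)ᵀ * G) * R.adjugate := by
          rw [hp, Matrix.map_mul, Matrix.transpose_mul]
          simp only [Matrix.mul_assoc]
      _ = (R.adjugate.map reflect)ᵀ * (X.map reflect)ᵀ * (Y.map C)ᵀ * (R * R.adjugate) +
          (R.adjugate.map reflect)ᵀ * (R.map reflect)ᵀ * (Y.map C * (X * R.adjugate)) := by
          rw [hmain]
          simp only [Matrix.mul_add, Matrix.add_mul, Matrix.mul_assoc]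
      _ = _ := by
          rw [hadj, Matrix.mul_adjugate, ← hE, ← Matrix.transpose_mul, ← Matrix.map_mul, ← hE,
            Matrix.mul_smul, Matrix.mul_one, Matrix.smul_mul, Matrix.one_mul]
  rw [mem_stateSpace_iff hR]
  intro j
  have hgoal : (G a ᵥ* R.adjugate) j = p a j := by rw [hp]; rfl
  rw [hgoal, Polynomial.degree_eq_natDegree hR]
  refine degree_lt_of_sum_comp_neg_mul (fun b => p b j) R.det.natDegree ?_ a
  have hsum : ∑ b, (p b j).comp (-Polynomial.X) * p b j =
      ∑ i, (R.det * (reflect (E i j) * C (Y j i)) + reflect R.det * (E i j * C (Y j i))) := by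
    have := congrFun (congrFun hprod j) j
    simp only [Matrix.mul_apply, Matrix.add_apply, Matrix.smul_apply, Matrix.transpose_apply,
      Matrix.map_apply, smul_eq_mul, Finset.mul_sum, mul_comm (C _) (E _ _)] at this
    rw [Finset.sum_add_distrib, ← this]
    rfl
  have hN : ((2 * R.det.natDegree : ℕ) : WithBot ℕ) = R.det.degree + R.det.degree := by
    rw [Polynomial.degree_eq_natDegree hR, two_mul]; rfl
  rw [hsum, hN]
  refine lt_of_le_of_lt (Polynomial.degree_sum_le _ _) ?_
  have hlt : ∀ f g : ℝ[X], f.degree = R.det.degree → ∀ c, g.degree < R.det.degree →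
      (f * (g * C c)).degree < R.det.degree + R.det.degree := fun f g hf c hg => by
    rw [Polynomial.degree_mul, hf]
    refine WithBot.add_lt_add_left (by simpa using hR) (lt_of_le_of_lt ?_ hg)
    rw [Polynomial.degree_mul]
    exact (add_le_add_right Polynomial.degree_C_le _).trans (by simp)
  rw [Finset.sup_lt_iff (by rw [← hN]; exact WithBot.bot_lt_coe _)]
  exact fun i _ => lt_of_le_of_lt (Polynomial.degree_add_le _ _) (max_lt
    (hlt _ _ rfl _ (by rw [degree_reflect]; exact hEdeg i j))
    (hlt _ _ (degree_reflect _) _ (hEdeg i j)))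

/-- The structured matrix, if negative semidefinite, factors through the coefficient matrix of the
state map. -/
theorem exists_lmiMatrix_eq {n q d : ℕ} {R : Matrix (Fin q) (Fin q) ℝ[X]} (hR : R.det ≠ 0)
    (hd : ∀ i j, (R i j).natDegree ≤ d) {X : Matrix (Fin n) (Fin q) ℝ[X]}
    (hX : IsMinimalStateMap R X) {K : Matrix (Fin n) (Fin n) ℝ} {Y : Matrix (Fin q) (Fin n) ℝ}
    (h : (-lmiMatrix d R X K Y).PosSemidef) :
    ∃ F : Matrix (Fin n) (Fin n) ℝ, lmiMatrix d R X K Y =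
      (padRight (coeffMatrix d X))ᵀ * F * padRight (coeffMatrix d X) := by
  obtain ⟨D, hD⟩ : ∃ D : Matrix (Fin (d + 1) × Fin q) (Fin (d + 1) × Fin q) ℝ,
      -lmiMatrix d R X K Y = Dᵀ * D := by
    open scoped MatrixOrder in
    obtain ⟨D, hD⟩ := CStarAlgebra.nonneg_iff_eq_star_mul_self.mp h.nonneg
    exact ⟨D, hD⟩
  rw [neg_eq_iff_eq_neg] at hD
  -- Each row of `D(ξ)` is a constant combination of the rows of `X`; comparison of coefficients
  -- turns this into `D = B [X̃ 0]`.
  choose B hB using fun a => hX.exists_vecMul (factor_row_mem_stateSpace hR hd hX hD a)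
  have hDB : D = Matrix.of B * padRight (coeffMatrix d X) := by
    rw [padRight_coeffMatrix _ fun i j => degree_lt_of_mem_stateSpace hR hd (hX.row_mem i) j]
    ext a ⟨i, j⟩
    have h1 := congrArg (fun f => Polynomial.coeff f (i : ℕ)) (congrFun (hB a) j)
    simp only [Matrix.mul_apply, Matrix.vecMul, dotProduct, powerColumn, Fintype.sum_prod_type,
      Matrix.map_apply, Matrix.of_apply, mul_ite, mul_zero, Finset.sum_ite_eq', Finset.mem_univ,
      if_true, Polynomial.finsetSum_coeff, Polynomial.coeff_C_mul, Polynomial.coeff_X_pow,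
      Fin.val_inj, mul_one, Finset.sum_ite_eq] at h1
    rw [h1]
    rfl
  refine ⟨-((Matrix.of B)ᵀ * Matrix.of B), ?_⟩
  rw [hD, hDB, Matrix.transpose_mul]
  simp only [Matrix.mul_assoc, Matrix.mul_neg, Matrix.neg_mul]

/-! ### Polynomial differential operators -/

/-- The value at `t` of `f(d/dt) w`, as a linear functional of the polynomial row vector `f`. -/
noncomputable def jetEval {q : ℕ} (w : ℝ → Fin q → ℝ) (t : ℝ) : (Fin q → ℝ[X]) →ₗ[ℝ] ℝ :=
  ∑ j, (Polynomial.lsum fun h => LinearMap.mulRight ℝ (iteratedDeriv h w t j)) ∘ₗ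
    LinearMap.proj j

theorem jetEval_apply {q : ℕ} (w : ℝ → Fin q → ℝ) (t : ℝ) (f : Fin q → ℝ[X]) :
    jetEval w t f = ∑ j, (f j).sum fun h a => a * iteratedDeriv h w t j := by
  simp [jetEval, Polynomial.lsum_apply]

theorem polyDiff_eq_jetEval {g q : ℕ} (G : Matrix (Fin g) (Fin q) ℝ[X]) (w : ℝ → Fin q → ℝ)
    (t : ℝ) (i : Fin g) : polyDiff G w t i = jetEval w t (G i) :=
  (jetEval_apply w t (G i)).symm

theorem jetEval_X_smul {q : ℕ} (w : ℝ → Fin q → ℝ) (t : ℝ) (f : Fin q → ℝ[X]) :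
    jetEval w t ((X : ℝ[X]) • f) =
      ∑ j, (f j).sum fun h a => a * iteratedDeriv (h + 1) w t j := by
  rw [jetEval_apply]
  refine Finset.sum_congr rfl fun j _ => ?_
  rw [Pi.smul_apply, smul_eq_mul,
    Polynomial.sum_over_range' (X * f j) (by simp) ((f j).natDegree + 2) (by
      refine Nat.lt_succ_of_le (Polynomial.natDegree_mul_le.trans ?_)
      rw [natDegree_X, add_comm]),
    Polynomial.sum_over_range' (f j) (by simp) ((f j).natDegree + 1) (Nat.lt_succ_self _),
    Finset.sum_range_succ']
  simp [coeff_X_mul]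

theorem hasDerivAt_iteratedDeriv {q : ℕ} {w : ℝ → Fin q → ℝ} (hw : ContDiff ℝ ∞ w) (h : ℕ)
    (t : ℝ) : HasDerivAt (iteratedDeriv h w) (iteratedDeriv (h + 1) w t) t := by
  rw [iteratedDeriv_succ]
  exact (hw.differentiable_iteratedDeriv h (by exact_mod_cast WithTop.coe_lt_top h) t).hasDerivAt

theorem hasDerivAt_jetEval {q : ℕ} {w : ℝ → Fin q → ℝ} (hw : ContDiff ℝ ∞ w)
    (f : Fin q → ℝ[X]) (t : ℝ) :
    HasDerivAt (fun t => jetEval w t f) (jetEval w t ((X : ℝ[X]) • f)) t := by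
  simp only [jetEval_X_smul]
  simp only [jetEval_apply, Polynomial.sum_def]
  exact HasDerivAt.fun_sum fun j _ => HasDerivAt.fun_sum fun h _ =>
    ((hasDerivAt_pi.1 (hasDerivAt_iteratedDeriv hw h t)) j).const_mul _

theorem hasDerivAt_polyDiff {g q : ℕ} {w : ℝ → Fin q → ℝ} (hw : ContDiff ℝ ∞ w)
    (G : Matrix (Fin g) (Fin q) ℝ[X]) (t : ℝ) :
    HasDerivAt (polyDiff G w) (polyDiff ((X : ℝ[X]) • G) w t) t := by
  rw [hasDerivAt_pi]
  intro i
  simp only [polyDiff_eq_jetEval]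
  exact hasDerivAt_jetEval hw (G i) t

/-- The rows `f` with `f(d/dt) w = 0`, a module over the polynomial ring. -/
noncomputable def annihilator {q : ℕ} {w : ℝ → Fin q → ℝ} (hw : ContDiff ℝ ∞ w) :
    Submodule ℝ[X] (Fin q → ℝ[X]) where
  carrier := {f | ∀ t, jetEval w t f = 0}
  add_mem' ha hb t := by rw [map_add, ha t, hb t, add_zero]
  zero_mem' t := map_zero _
  smul_mem' p f hf := by
    have hX : ∀ g : Fin q → ℝ[X], (∀ t, jetEval w t g = 0) →
        ∀ t, jetEval w t ((X : ℝ[X]) • g) = 0 := fun g hg t => by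
      rw [← (hasDerivAt_jetEval hw g t).deriv, funext hg, deriv_const]
    have hXn : ∀ (n : ℕ) t, jetEval w t ((X : ℝ[X]) ^ n • f) = 0 := fun n => by
      induction n with
      | zero => simpa using hf
      | succ n ih =>
        intro t
        rw [pow_succ', mul_smul]
        exact hX _ ih t
    intro t
    induction p using Polynomial.induction_on' with
    | add p r hp hr => rw [add_smul, map_add, hp, hr, add_zero]
    | monomial n a =>
      rw [← Polynomial.smul_X_eq_monomial, smul_assoc, map_smul, hXn, smul_zero]

theorem polyDiff_mul_eq_zero {g m q : ℕ} {R : Matrix (Fin m) (Fin q) ℝ[X]} {w : ℝ → Fin q → ℝ}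
    (hw : w ∈ kerBehaviour R) (P : Matrix (Fin g) (Fin m) ℝ[X]) (t : ℝ) :
    polyDiff (P * R) w t = 0 := by
  ext i
  rw [polyDiff_eq_jetEval]
  have hrow : (P * R) i ∈ annihilator hw.1 := by
    have : (P * R) i = ∑ l, P i l • R l := by
      ext1 j
      simp [Matrix.mul_apply]
    rw [this]
    refine Submodule.sum_mem _ fun l _ => Submodule.smul_mem _ _ fun t => ?_
    rw [← polyDiff_eq_jetEval, hw.2 t, Pi.zero_apply]
  exact hrow t

theorem polyDiff_add {g q : ℕ} (G H : Matrix (Fin g) (Fin q) ℝ[X]) (w : ℝ → Fin q → ℝ) (t : ℝ) :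
    polyDiff (G + H) w t = polyDiff G w t + polyDiff H w t := by
  ext i
  simp only [polyDiff_eq_jetEval, Pi.add_apply]
  exact map_add _ _ _

theorem polyDiff_map_C_mul {g m q : ℕ} (A : Matrix (Fin g) (Fin m) ℝ)
    (G : Matrix (Fin m) (Fin q) ℝ[X]) (w : ℝ → Fin q → ℝ) (t : ℝ) :
    polyDiff (A.map C * G) w t = A *ᵥ polyDiff G w t := by
  ext i
  have : (A.map C * G) i = ∑ l, A i l • G l := by
    ext1 j
    simp [Matrix.mul_apply, Polynomial.smul_eq_C_mul]
  rw [polyDiff_eq_jetEval, this, map_sum]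
  simp only [map_smul, Matrix.mulVec, dotProduct, polyDiff_eq_jetEval, smul_eq_mul]

theorem polyDiff_one {q : ℕ} (w : ℝ → Fin q → ℝ) (t : ℝ) :
    polyDiff (1 : Matrix (Fin q) (Fin q) ℝ[X]) w t = w t := by
  ext i
  rw [polyDiff, Finset.sum_eq_single i]
  · rw [Matrix.one_apply_eq, ← C_1, sum_C_index] <;> simp
  · intro j _ hj
    rw [Matrix.one_apply_ne hj.symm, sum_zero_index]
  · simp

/-- Along `ker R(d/dt)` the operator `(A X + P R)(d/dt)` is `A X(d/dt)`. -/
theorem polyDiff_eq_mulVec {g n q : ℕ} {R : Matrix (Fin q) (Fin q) ℝ[X]}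
    {X : Matrix (Fin n) (Fin q) ℝ[X]} {G : Matrix (Fin g) (Fin q) ℝ[X]}
    {A : Matrix (Fin g) (Fin n) ℝ} {P : Matrix (Fin g) (Fin q) ℝ[X]}
    (hG : G = A.map C * X + P * R) {w : ℝ → Fin q → ℝ} (hw : w ∈ kerBehaviour R) (t : ℝ) :
    polyDiff G w t = A *ᵥ polyDiff X w t := by
  rw [hG, polyDiff_add, polyDiff_mul_eq_zero hw, add_zero, polyDiff_map_C_mul]

theorem polyDiff_congr {g q : ℕ} (G : Matrix (Fin g) (Fin q) ℝ[X]) {w v : ℝ → Fin q → ℝ} {t : ℝ}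
    (h : w =ᶠ[𝓝 t] v) : polyDiff G w t = polyDiff G v t := by
  ext i
  simp only [polyDiff, h.iteratedDeriv_eq]

/-! ### Linear differential behaviours -/

theorem jetEval_deriv {q : ℕ} (w : ℝ → Fin q → ℝ) (t : ℝ) (f : Fin q → ℝ[X]) :
    jetEval (deriv w) t f = jetEval w t ((X : ℝ[X]) • f) := by
  rw [jetEval_X_smul, jetEval_apply]
  simp only [iteratedDeriv_succ']

theorem deriv_mem_kerBehaviour {m q : ℕ} {R : Matrix (Fin m) (Fin q) ℝ[X]} {w : ℝ → Fin q → ℝ}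
    (hw : w ∈ kerBehaviour R) : deriv w ∈ kerBehaviour R := by
  refine ⟨?_, fun t => ?_⟩
  · exact (contDiff_infty_iff_deriv.1 hw.1).2
  · ext i
    rw [polyDiff_eq_jetEval, jetEval_deriv]
    have : R i ∈ annihilator hw.1 := fun t => by
      rw [← polyDiff_eq_jetEval, hw.2 t, Pi.zero_apply]
    exact Submodule.smul_mem _ X this t

theorem iteratedDeriv_mem_kerBehaviour {m q : ℕ} {R : Matrix (Fin m) (Fin q) ℝ[X]}
    {w : ℝ → Fin q → ℝ} (hw : w ∈ kerBehaviour R) (h : ℕ) :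
    iteratedDeriv h w ∈ kerBehaviour R := by
  induction h with
  | zero => simpa using hw
  | succ h ih => rw [iteratedDeriv_succ]; exact deriv_mem_kerBehaviour ih

/-- In an asymptotically stable behaviour all derivatives tend to `0` too, because the behaviour
is invariant under differentiation. -/
theorem tendsto_polyDiff {m g q : ℕ} {R : Matrix (Fin m) (Fin q) ℝ[X]}
    (hs : AsymptoticallyStable (kerBehaviour R)) {w : ℝ → Fin q → ℝ} (hw : w ∈ kerBehaviour R)
    (G : Matrix (Fin g) (Fin q) ℝ[X]) : Tendsto (polyDiff G w) atTop (𝓝 0) := by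
  rw [tendsto_pi_nhds]
  intro i
  have h : ∀ j h, Tendsto (fun t => (G i j).coeff h * iteratedDeriv h w t j) atTop (𝓝 0) :=
    fun j h => by
      have := (tendsto_pi_nhds.1 (hs _ (iteratedDeriv_mem_kerBehaviour hw h)) j).const_mul
        ((G i j).coeff h)
      simpa using this
  have := tendsto_finsetSum (Finset.univ : Finset (Fin q)) fun j _ =>
    tendsto_finsetSum ((G i j).support) fun h' _ => h j h'
  simpa [polyDiff, Polynomial.sum_def] using this

theorem polyDiff_comp_add_const {m q : ℕ} (R : Matrix (Fin m) (Fin q) ℝ[X]) (w : ℝ → Fin q → ℝ)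
    (c t : ℝ) : polyDiff R (fun s => w (s + c)) t = polyDiff R w (t + c) := by
  ext i
  simp only [polyDiff, iteratedDeriv_comp_add_const]

theorem comp_add_const_mem_kerBehaviour {m q : ℕ} {R : Matrix (Fin m) (Fin q) ℝ[X]}
    {w : ℝ → Fin q → ℝ} (hw : w ∈ kerBehaviour R) (c : ℝ) :
    (fun s => w (s + c)) ∈ kerBehaviour R :=
  ⟨hw.1.comp (contDiff_id.add contDiff_const), fun t => by
    rw [polyDiff_comp_add_const]; exact hw.2 _⟩

theorem polyDiff_add_right {m q : ℕ} (R : Matrix (Fin m) (Fin q) ℝ[X]) {v w : ℝ → Fin q → ℝ}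
    (hv : ContDiff ℝ ∞ v) (hw : ContDiff ℝ ∞ w) (t : ℝ) :
    polyDiff R (v + w) t = polyDiff R v t + polyDiff R w t := by
  have h : ∀ h : ℕ, iteratedDeriv h (v + w) t = iteratedDeriv h v t + iteratedDeriv h w t :=
    fun h => iteratedDeriv_add (hv.contDiffAt.of_le (by exact_mod_cast le_top))
      (hw.contDiffAt.of_le (by exact_mod_cast le_top))
  ext i
  simp only [polyDiff, h, Pi.add_apply, mul_add, Polynomial.sum_def, Finset.sum_add_distrib]

theorem polyDiff_smul_right {m q : ℕ} (R : Matrix (Fin m) (Fin q) ℝ[X]) {w : ℝ → Fin q → ℝ}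
    (hw : ContDiff ℝ ∞ w) (c t : ℝ) :
    polyDiff R (c • w) t = c • polyDiff R w t := by
  have h : ∀ h : ℕ, iteratedDeriv h (c • w) t = c • iteratedDeriv h w t :=
    fun h => iteratedDeriv_const_smul (hw.contDiffAt.of_le (by exact_mod_cast le_top)) c
  ext i
  simp only [polyDiff, h, Pi.smul_apply, smul_eq_mul, Polynomial.sum_def, Finset.mul_sum,
    mul_left_comm]

/-- The states at time `0` of the trajectories in `ker R(d/dt)`. -/
noncomputable def reachableStates {m n q : ℕ} (R : Matrix (Fin m) (Fin q) ℝ[X])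
    (X : Matrix (Fin n) (Fin q) ℝ[X]) : Submodule ℝ (Fin n → ℝ) where
  carrier := {x | ∃ w ∈ kerBehaviour R, polyDiff X w 0 = x}
  add_mem' := by
    rintro _ _ ⟨v, hv, rfl⟩ ⟨w, hw, rfl⟩
    exact ⟨v + w, ⟨hv.1.add hw.1, fun t => by
      rw [polyDiff_add_right _ hv.1 hw.1, hv.2, hw.2, add_zero]⟩,
      polyDiff_add_right _ hv.1 hw.1 0⟩
  zero_mem' := ⟨0, ⟨contDiff_const, fun t => by
    ext i; simp [polyDiff, Polynomial.sum_def]⟩, by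
    ext i; simp [polyDiff, Polynomial.sum_def]⟩
  smul_mem' := by
    rintro c _ ⟨w, hw, rfl⟩
    exact ⟨c • w, ⟨hw.1.const_smul c, fun t => by
      rw [polyDiff_smul_right _ hw.1, hw.2, smul_zero]⟩, polyDiff_smul_right _ hw.1 c 0⟩

theorem polyDiff_mem_reachableStates {m n q : ℕ} {R : Matrix (Fin m) (Fin q) ℝ[X]}
    (X : Matrix (Fin n) (Fin q) ℝ[X]) {w : ℝ → Fin q → ℝ} (hw : w ∈ kerBehaviour R) (t : ℝ) :
    polyDiff X w t ∈ reachableStates R X :=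
  ⟨fun s => w (s + t), comp_add_const_mem_kerBehaviour hw t, by
    rw [polyDiff_comp_add_const, zero_add]⟩

/-! ### The quadratic differential form in terms of the state -/

/-- The functional on two-variable polynomials underlying the entries of `qdf`. -/
noncomputable def biEval (a b : ℕ → ℝ) : MvPolynomial (Fin 2) ℝ →ₗ[ℝ] ℝ :=
  (MvPolynomial.basisMonomials (Fin 2) ℝ).constr ℝ fun m => a (m 0) * b (m 1)

theorem biEval_apply (a b : ℕ → ℝ) (Φ : MvPolynomial (Fin 2) ℝ) :
    biEval a b Φ = ∑ m ∈ Φ.support, a (m 0) * Φ.coeff m * b (m 1) := by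
  conv_lhs => rw [Φ.as_sum, map_sum]
  refine Finset.sum_congr rfl fun m _ => ?_
  have h1 : MvPolynomial.monomial m (Φ.coeff m) =
      Φ.coeff m • MvPolynomial.basisMonomials (Fin 2) ℝ m := by
    simp [MvPolynomial.smul_monomial]
  rw [h1, map_smul, biEval, Module.Basis.constr_basis, smul_eq_mul]
  ring

theorem biEval_mul (a b : ℕ → ℝ) (p r : ℝ[X]) (c : ℝ) :
    biEval a b (Polynomial.aeval (MvPolynomial.X 0) p * MvPolynomial.C c *
      Polynomial.aeval (MvPolynomial.X 1) r) =
      (p.sum fun h x => x * a h) * c * r.sum fun h x => x * b h := by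
  induction p using Polynomial.induction_on' with
  | add p p' hp hp' =>
    rw [map_add, add_mul, add_mul, map_add, hp, hp',
      Polynomial.sum_add_index _ _ _ (by simp) (by intros; ring), add_mul, add_mul]
  | monomial h x =>
    induction r using Polynomial.induction_on' with
    | add r r' hr hr' =>
      rw [map_add, mul_add, map_add, hr, hr',
        Polynomial.sum_add_index r r' _ (by simp) (by intros; ring), mul_add]
    | monomial k y =>
      rw [Polynomial.sum_monomial_index _ _ (by simp), Polynomial.sum_monomial_index _ _ (by simp),
        Polynomial.aeval_monomial, Polynomial.aeval_monomial]
      have h1 : algebraMap ℝ (MvPolynomial (Fin 2) ℝ) x * MvPolynomial.X 0 ^ h *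
          MvPolynomial.C c * (algebraMap ℝ (MvPolynomial (Fin 2) ℝ) y * MvPolynomial.X 1 ^ k) =
          (x * c * y) • MvPolynomial.basisMonomials (Fin 2) ℝ
            (Finsupp.single 0 h + Finsupp.single 1 k) := by
        rw [MvPolynomial.coe_basisMonomials, MvPolynomial.smul_monomial, smul_eq_mul, mul_one,
          MvPolynomial.monomial_eq, Finsupp.prod_add_index' (by simp) (by simp [pow_add]),
          Finsupp.prod_single_index (by simp), Finsupp.prod_single_index (by simp)]
        simp only [MvPolynomial.algebraMap_eq, map_mul]
        ring
      rw [h1, map_smul, biEval, Module.Basis.constr_basis]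
      simp
      ring

theorem qdf_quadraticForm {n q : ℕ} (X : Matrix (Fin n) (Fin q) ℝ[X])
    (K : Matrix (Fin n) (Fin n) ℝ) (w : ℝ → Fin q → ℝ) (t : ℝ) :
    qdf (quadraticForm X K) w t = polyDiff X w t ⬝ᵥ K *ᵥ polyDiff X w t := by
  simp only [qdf]
  have h : ∀ i j, ∑ m ∈ (quadraticForm X K i j).support, iteratedDeriv (m 0) w t i *
      (quadraticForm X K i j).coeff m * iteratedDeriv (m 1) w t j =
      ∑ a, ∑ b, ((X a i).sum fun h x => x * iteratedDeriv h w t i) * K a b *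
        ((X b j).sum fun h x => x * iteratedDeriv h w t j) := fun i j => by
    rw [← biEval_apply (fun h => iteratedDeriv h w t i) (fun h => iteratedDeriv h w t j)]
    simp only [quadraticForm, inVariable, Matrix.mul_apply, Matrix.transpose_apply,
      Matrix.map_apply, Finset.sum_mul, map_sum, biEval_mul]
    exact Finset.sum_comm
  obtain ⟨u, hu⟩ : ∃ u : Fin n → Fin q → ℝ, ∀ a i,
      ((X a i).sum fun h x => x * iteratedDeriv h w t i) = u a i := ⟨_, fun _ _ => rfl⟩
  simp only [h, dotProduct, Matrix.mulVec, polyDiff, hu]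
  calc _ = ∑ i, ∑ a, ∑ j, ∑ b, u a i * K a b * u b j :=
        Finset.sum_congr rfl fun i _ => Finset.sum_comm
    _ = ∑ a, ∑ i, ∑ j, ∑ b, u a i * K a b * u b j := Finset.sum_comm
    _ = _ := Finset.sum_congr rfl fun a _ => by
        rw [Finset.sum_mul]
        refine Finset.sum_congr rfl fun i _ => ?_
        rw [Finset.sum_comm, Finset.mul_sum]
        refine Finset.sum_congr rfl fun b _ => ?_
        rw [Finset.mul_sum, Finset.mul_sum]
        exact Finset.sum_congr rfl fun j _ => mul_assoc _ _ _

/-! ### The derivative of the storage function -/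

/-- The vector of the derivatives of `w` at `t` of order at most `d`. -/
noncomputable def jet {q : ℕ} (d : ℕ) (w : ℝ → Fin q → ℝ) (t : ℝ) : Fin (d + 1) × Fin q → ℝ :=
  fun p => iteratedDeriv p.1 w t p.2

theorem coeffMatrix_mulVec_jet {m d q : ℕ} {G : Matrix (Fin m) (Fin q) ℝ[X]}
    (hG : ∀ i j, (G i j).natDegree ≤ d) (w : ℝ → Fin q → ℝ) (t : ℝ) :
    coeffMatrix (d + 1) G *ᵥ jet d w t = polyDiff G w t := by
  ext i
  simp only [Matrix.mulVec, dotProduct, coeffMatrix, jet, polyDiff, Matrix.of_apply]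
  rw [Fintype.sum_prod_type_right]
  refine Finset.sum_congr rfl fun j _ => ?_
  rw [Polynomial.sum_over_range' _ (by simp) (d + 1) (Nat.lt_succ_of_le (hG i j)),
    ← Fin.sum_univ_eq_sum_range (fun h => (G i j).coeff h * iteratedDeriv h w t j)]

theorem dotProduct_transpose_mul_mul_mulVec {ι m m' : Type*} [Fintype ι] [Fintype m] [Fintype m']
    (A : Matrix m ι ℝ) (M : Matrix m m' ℝ) (B : Matrix m' ι ℝ) (v : ι → ℝ) :
    v ⬝ᵥ (Aᵀ * M * B) *ᵥ v = (A *ᵥ v) ⬝ᵥ M *ᵥ (B *ᵥ v) := by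
  rw [← Matrix.mulVec_mulVec, ← Matrix.mulVec_mulVec, Matrix.dotProduct_mulVec,
    Matrix.vecMul_transpose]

/-- Contracting the structured matrix with the jet of a trajectory yields the derivative of the
storage function, as the terms with `R` vanish. -/
theorem hasDerivAt_storage {n q d : ℕ} {R : Matrix (Fin q) (Fin q) ℝ[X]} (hR : R.det ≠ 0)
    (hd : ∀ i j, (R i j).natDegree ≤ d) {X : Matrix (Fin n) (Fin q) ℝ[X]}
    (hX : IsMinimalStateMap R X) {K F : Matrix (Fin n) (Fin n) ℝ} {Y : Matrix (Fin q) (Fin n) ℝ}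
    (hF : lmiMatrix d R X K Y =
      (padRight (coeffMatrix d X))ᵀ * F * padRight (coeffMatrix d X))
    {w : ℝ → Fin q → ℝ} (hw : w ∈ kerBehaviour R) (t : ℝ) :
    HasDerivAt (fun t => polyDiff X w t ⬝ᵥ K *ᵥ polyDiff X w t)
      (polyDiff X w t ⬝ᵥ F *ᵥ polyDiff X w t) t := by
  have hdX : ∀ i j, (X i j).degree < d := fun i j =>
    degree_lt_of_mem_stateSpace hR hd (hX.row_mem i) j
  have hdX' : ∀ i j, (X i j).natDegree ≤ d := fun i j =>
    Polynomial.natDegree_le_iff_degree_le.2 (hdX i j).le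
  have hdX'' := natDegree_X_smul_le hdX
  have hx := hasDerivAt_polyDiff hw.1 X t
  have hval : polyDiff X w t ⬝ᵥ F *ᵥ polyDiff X w t =
      polyDiff ((Polynomial.X : ℝ[X]) • X) w t ⬝ᵥ K *ᵥ polyDiff X w t +
        polyDiff X w t ⬝ᵥ K *ᵥ polyDiff ((Polynomial.X : ℝ[X]) • X) w t := by
    have h := congrArg (fun M => jet d w t ⬝ᵥ M *ᵥ jet d w t) hF
    simp only [lmiMatrix, padRight_coeffMatrix _ hdX, padLeft_coeffMatrix, Matrix.sub_mulVec,
      Matrix.add_mulVec, dotProduct_sub, dotProduct_add, dotProduct_transpose_mul_mul_mulVec,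
      coeffMatrix_mulVec_jet hd, coeffMatrix_mulVec_jet hdX', coeffMatrix_mulVec_jet hdX'',
      hw.2 t, Matrix.mulVec_zero, dotProduct_zero, zero_dotProduct, sub_zero] at h
    exact h.symm
  rw [hval]
  have hKx : ∀ i, HasDerivAt (fun t => (K *ᵥ polyDiff X w t) i)
      ((K *ᵥ polyDiff ((Polynomial.X : ℝ[X]) • X) w t) i) t := fun i => by
    simp only [Matrix.mulVec, dotProduct]
    exact HasDerivAt.fun_sum fun j _ => (hasDerivAt_pi.1 hx j).const_mul _
  have := HasDerivAt.fun_sum (u := Finset.univ) fun i _ => (hasDerivAt_pi.1 hx i).mul (hKx i)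
  rw [Finset.sum_add_distrib] at this
  exact this

/-! ### Quadratic bounds -/

/-- By compactness of the unit sphere, a quadratic form that is positive on a subspace dominates
there every other quadratic form, up to a factor. -/
theorem exists_quadratic_le {n : ℕ} (W : Submodule ℝ (Fin n → ℝ)) (P B : Matrix (Fin n) (Fin n) ℝ)
    (hP : ∀ x ∈ W, x ≠ 0 → 0 < x ⬝ᵥ P *ᵥ x) :
    ∃ M : ℝ, 0 < M ∧ ∀ x ∈ W, x ⬝ᵥ B *ᵥ x ≤ M * (x ⬝ᵥ P *ᵥ x) := by
  have hcont : ∀ A : Matrix (Fin n) (Fin n) ℝ, Continuous fun x : Fin n → ℝ => x ⬝ᵥ A *ᵥ x :=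
    fun A => continuous_id.dotProduct (continuous_const.matrix_mulVec continuous_id)
  have hne : ∀ x ∈ Metric.sphere (0 : Fin n → ℝ) 1, x ≠ 0 := fun x hx =>
    ne_zero_of_mem_unit_sphere ⟨x, hx⟩
  have hcomp : IsCompact (Metric.sphere (0 : Fin n → ℝ) 1 ∩ (W : Set (Fin n → ℝ))) :=
    (isCompact_sphere _ _).inter_right W.closed_of_finiteDimensional
  obtain ⟨M, hM⟩ := (hcomp.bddAbove_image (f := fun x => (x ⬝ᵥ B *ᵥ x) / (x ⬝ᵥ P *ᵥ x))
    ((hcont B).continuousOn.div (hcont P).continuousOn fun x hx =>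
      (hP x hx.2 (hne x hx.1)).ne'))
  refine ⟨max M 1, by positivity, fun x hx => ?_⟩
  by_cases h0 : x = 0
  · simp [h0]
  have hn : 0 < ‖x‖ := norm_pos_iff.2 h0
  have hy : ‖x‖⁻¹ • x ∈ Metric.sphere (0 : Fin n → ℝ) 1 ∩ (W : Set (Fin n → ℝ)) :=
    ⟨by simp [norm_smul, hn.ne'], W.smul_mem _ hx⟩
  have h1 := hM ⟨_, hy, rfl⟩
  have hsc : ∀ A : Matrix (Fin n) (Fin n) ℝ,
      (‖x‖⁻¹ • x) ⬝ᵥ A *ᵥ (‖x‖⁻¹ • x) = (‖x‖⁻¹ * ‖x‖⁻¹) * (x ⬝ᵥ A *ᵥ x) := fun A => by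
    simp [Matrix.mulVec_smul, mul_assoc]
  have hPx := hP x hx h0
  simp only [hsc] at h1
  rw [mul_div_mul_left _ _ (by positivity), div_le_iff₀ hPx] at h1
  exact h1.trans (mul_le_mul_of_nonneg_right (le_max_left _ _) hPx.le)

/-! ### Storage functions of a single mode -/

/-- The data of a mode `ker R(d/dt)` with state `X(d/dt) w` on which the storage function `xᵀ K x`
has the negative definite derivative `xᵀ F x`. -/
structure IsStrictStorage {n q : ℕ} (R : Matrix (Fin q) (Fin q) ℝ[X])
    (X : Matrix (Fin n) (Fin q) ℝ[X]) (K F : Matrix (Fin n) (Fin n) ℝ) : Prop where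
  stable : AsymptoticallyStable (kerBehaviour R)
  observable : ∃ C : Matrix (Fin q) (Fin n) ℝ,
    ∀ w ∈ kerBehaviour R, ∀ t, w t = C *ᵥ polyDiff X w t
  hasDerivAt : ∀ w ∈ kerBehaviour R, ∀ t,
    HasDerivAt (fun t => polyDiff X w t ⬝ᵥ K *ᵥ polyDiff X w t)
      (polyDiff X w t ⬝ᵥ F *ᵥ polyDiff X w t) t
  posDef_neg : (-F).PosDef

theorem observable_of_isMinimalStateMap {n q : ℕ} {R : Matrix (Fin q) (Fin q) ℝ[X]}
    (hR : R.det ≠ 0) {X : Matrix (Fin n) (Fin q) ℝ[X]} (hX : IsMinimalStateMap R X) :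
    ∃ C : Matrix (Fin q) (Fin n) ℝ, ∀ w ∈ kerBehaviour R, ∀ t, w t = C *ᵥ polyDiff X w t := by
  obtain ⟨C, P, h⟩ := hX.exists_eq hR (1 : Matrix (Fin q) (Fin q) ℝ[X])
  exact ⟨C, fun w hw t => by rw [← polyDiff_eq_mulVec h hw, polyDiff_one]⟩

namespace IsStrictStorage

variable {n q : ℕ} {R : Matrix (Fin q) (Fin q) ℝ[X]} {X : Matrix (Fin n) (Fin q) ℝ[X]}
  {K F : Matrix (Fin n) (Fin n) ℝ} {w : ℝ → Fin q → ℝ}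

theorem dotProduct_neg (h : IsStrictStorage R X K F) {x : Fin n → ℝ} (hx : x ≠ 0) :
    x ⬝ᵥ F *ᵥ x < 0 := by
  have := h.posDef_neg.dotProduct_mulVec_pos hx
  simpa [Matrix.neg_mulVec] using this

theorem dotProduct_nonpos (h : IsStrictStorage R X K F) (x : Fin n → ℝ) :
    x ⬝ᵥ F *ᵥ x ≤ 0 := by
  by_cases hx : x = 0
  · simp [hx]
  · exact (h.dotProduct_neg hx).le

theorem nonneg (h : IsStrictStorage R X K F) (hw : w ∈ kerBehaviour R) (t : ℝ) :
    0 ≤ polyDiff X w t ⬝ᵥ K *ᵥ polyDiff X w t := by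
  have hanti : Antitone fun t => polyDiff X w t ⬝ᵥ K *ᵥ polyDiff X w t :=
    antitone_of_hasDerivAt_nonpos (h.hasDerivAt w hw) fun t => h.dotProduct_nonpos _
  refine hanti.le_of_tendsto (f := fun t => polyDiff X w t ⬝ᵥ K *ᵥ polyDiff X w t) ?_ t
  have hcont : Continuous fun x : Fin n → ℝ => x ⬝ᵥ K *ᵥ x :=
    continuous_id.dotProduct (continuous_const.matrix_mulVec continuous_id)
  have := (hcont.tendsto 0).comp (tendsto_polyDiff h.stable hw X)
  simpa [Function.comp_def] using this

/-- A zero of the storage function is a minimum, so its derivative vanishes there. -/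
theorem state_eq_zero (h : IsStrictStorage R X K F) (hw : w ∈ kerBehaviour R) {t : ℝ}
    (ht : polyDiff X w t ⬝ᵥ K *ᵥ polyDiff X w t = 0) : polyDiff X w t = 0 := by
  by_contra hx
  have hmin : IsLocalMin (fun t => polyDiff X w t ⬝ᵥ K *ᵥ polyDiff X w t) t :=
    Filter.Eventually.of_forall fun s => by
      simp only [ht]
      exact h.nonneg hw s
  exact (h.dotProduct_neg hx).ne (hmin.hasDerivAt_eq_zero (h.hasDerivAt w hw t))

/-- The storage function bounds the trajectory, and is bounded by its dissipation rate. -/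
theorem exists_bound (h : IsStrictStorage R X K F) : ∃ M : ℝ, 0 < M ∧ ∀ w ∈ kerBehaviour R, ∀ t,
    (∀ i, w t i ^ 2 ≤ M * (polyDiff X w t ⬝ᵥ K *ᵥ polyDiff X w t)) ∧
    polyDiff X w t ⬝ᵥ K *ᵥ polyDiff X w t ≤ M * -(polyDiff X w t ⬝ᵥ F *ᵥ polyDiff X w t) := by
  obtain ⟨C, hC⟩ := h.observable
  obtain ⟨M₁, hM₁, h₁⟩ := exists_quadratic_le (reachableStates R X) K (Cᵀ * C) (by
    rintro _ ⟨v, hv, rfl⟩ hx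
    exact lt_of_le_of_ne (h.nonneg hv 0) fun h0 => hx (h.state_eq_zero hv h0.symm))
  obtain ⟨M₂, hM₂, h₂⟩ := exists_quadratic_le ⊤ (-F) K (by
    intro x _ hx
    rw [Matrix.neg_mulVec, _root_.dotProduct_neg]
    exact neg_pos.2 (h.dotProduct_neg hx))
  refine ⟨M₁ + M₂, by positivity, fun w hw t => ⟨fun i => ?_, ?_⟩⟩
  · calc w t i ^ 2 ≤ w t ⬝ᵥ w t := by
          rw [sq]
          exact Finset.single_le_sum (f := fun i => w t i * w t i)
            (fun j _ => mul_self_nonneg _) (Finset.mem_univ i)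
      _ = polyDiff X w t ⬝ᵥ (Cᵀ * C) *ᵥ polyDiff X w t := by
          rw [← Matrix.mulVec_mulVec, Matrix.dotProduct_mulVec, Matrix.vecMul_transpose,
            ← hC w hw t]
      _ ≤ M₁ * _ := h₁ _ (polyDiff_mem_reachableStates X hw t)
      _ ≤ _ := mul_le_mul_of_nonneg_right (by linarith) (h.nonneg hw t)
  · have := h₂ (polyDiff X w t) trivial
    rw [Matrix.neg_mulVec, _root_.dotProduct_neg] at this
    exact this.trans (mul_le_mul_of_nonneg_right (by linarith)
      (neg_nonneg.2 (h.dotProduct_nonpos _)))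

/-- Within a mode the storage function decays at every rate `α` that the dissipation allows. -/
theorem antitone_exp_mul (h : IsStrictStorage R X K F) (hw : w ∈ kerBehaviour R) {α : ℝ}
    (hα : ∀ t, α * (polyDiff X w t ⬝ᵥ K *ᵥ polyDiff X w t) ≤
      -(polyDiff X w t ⬝ᵥ F *ᵥ polyDiff X w t)) :
    Antitone fun t => Real.exp (α * t) * (polyDiff X w t ⬝ᵥ K *ᵥ polyDiff X w t) := by
  have hexp : ∀ t, HasDerivAt (fun t => Real.exp (α * t)) (Real.exp (α * t) * α) t := fun t => by
    simpa using ((hasDerivAt_id t).const_mul α).exp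
  refine antitone_of_hasDerivAt_nonpos (fun t => (hexp t).mul (h.hasDerivAt w hw t)) fun t => ?_
  have := hα t
  have h0 := Real.exp_pos (α * t)
  calc _ = Real.exp (α * t) * (α * (polyDiff X w t ⬝ᵥ K *ᵥ polyDiff X w t) +
        polyDiff X w t ⬝ᵥ F *ᵥ polyDiff X w t) := by ring
    _ ≤ 0 := mul_nonpos_of_nonneg_of_nonpos h0.le (by linarith)

end IsStrictStorage

/-! ### The modal matrix -/

theorem evalAt_mul {l m q : ℕ} (P : Matrix (Fin l) (Fin m) ℝ[X]) (G : Matrix (Fin m) (Fin q) ℝ[X])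
    (z : ℂ) : evalAt (P * G) z = evalAt P z * evalAt G z :=
  Matrix.map_mul (f := (Polynomial.aeval z : ℝ[X] →ₐ[ℝ] ℂ))

theorem modalMatrix_mulVec {n q : ℕ} (X : Matrix (Fin n) (Fin q) ℝ[X]) (z : Fin n → ℂ)
    (w : Fin n → Fin q → ℂ) (c : Fin n → ℂ) :
    modalMatrix X z w *ᵥ c = ∑ i, c i • (evalAt X (z i) *ᵥ w i) := by
  ext a
  simp [modalMatrix, Matrix.mulVec, dotProduct, mul_comm]

/-- Since every row is a constant combination of the rows of `X` modulo `R`, a relation between the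
columns `X(z_i) w_i` persists between the vectors `g(z_i) w_i` for every polynomial `g`; taking for
`g` a polynomial that vanishes at all `z_i` but one isolates a single eigenvalue. -/
theorem isUnit_modalMatrix {n q : ℕ} {R : Matrix (Fin q) (Fin q) ℝ[X]} (hR : R.det ≠ 0)
    {X : Matrix (Fin n) (Fin q) ℝ[X]} (hX : IsMinimalStateMap R X) {z : Fin n → ℂ}
    {w : Fin n → Fin q → ℂ} (hw : ∀ i, evalAt R (z i) *ᵥ w i = 0)
    (hwind : ∀ μ : ℂ, LinearIndependent ℂ (fun i : {i // z i = μ} => w i)) :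
    IsUnit (modalMatrix X z w) := by
  rw [← Matrix.mulVec_injective_iff_isUnit]
  rw [← Matrix.coe_mulVecLin, injective_iff_map_eq_zero]
  intro c hc
  rw [Matrix.mulVecLin_apply, modalMatrix_mulVec] at hc
  have hpow : ∀ h : ℕ, ∑ i, (c i * z i ^ h) • w i = 0 := fun h => by
    obtain ⟨A, P, hAP⟩ := hX.exists_eq hR ((Polynomial.X : ℝ[X]) ^ h • (1 : Matrix (Fin q) (Fin q) ℝ[X]))
    have hi : ∀ i, (z i ^ h) • w i = toComplex A *ᵥ (evalAt X (z i) *ᵥ w i) := fun i => by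
      have h1 : evalAt ((Polynomial.X : ℝ[X]) ^ h • (1 : Matrix (Fin q) (Fin q) ℝ[X])) (z i) =
          z i ^ h • (1 : Matrix (Fin q) (Fin q) ℂ) := by
        ext1 a b
        by_cases hab : a = b <;> simp [evalAt, hab]
      have h2 : evalAt (A.map C * X + P * R) (z i) =
          toComplex A * evalAt X (z i) + evalAt P (z i) * evalAt R (z i) := by
        rw [← evalAt_mul P]
        have : evalAt (A.map C) (z i) = toComplex A := by
          ext1 a b
          simp [evalAt, toComplex]
        rw [← this, ← evalAt_mul]
        exact Matrix.map_add _ (map_add (Polynomial.aeval (z i))) _ _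
      rw [← hAP, h1] at h2
      have h3 := congrArg (fun M => M *ᵥ w i) h2
      simp only [Matrix.add_mulVec, ← Matrix.mulVec_mulVec, hw, Matrix.mulVec_zero, add_zero,
        Matrix.smul_mulVec, Matrix.one_mulVec] at h3
      exact h3
    have h4 := congrArg (fun v => toComplex A *ᵥ v) hc
    simp only [Matrix.mulVec_sum, Matrix.mulVec_smul, Matrix.mulVec_zero, ← hi, smul_smul] at h4
    exact h4
  have hpoly : ∀ p : ℂ[X], ∑ i, (c i * p.eval (z i)) • w i = 0 := fun p => by
    induction p using Polynomial.induction_on' with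
    | add p r hp hr =>
      simp only [Polynomial.eval_add, mul_add, add_smul, Finset.sum_add_distrib, hp, hr, add_zero]
    | monomial h a =>
      have := congrArg (fun v => a • v) (hpow h)
      simp only [Finset.smul_sum, smul_smul, smul_zero] at this
      rw [← this]
      refine Finset.sum_congr rfl fun i _ => ?_
      rw [Polynomial.eval_monomial]
      ring_nf
  ext i
  classical
  obtain ⟨p, hp0, hp⟩ : ∃ p : ℂ[X], p.eval (z i) ≠ 0 ∧ ∀ j, z j ≠ z i → p.eval (z j) = 0 := by
    refine ⟨∏ ν ∈ (Finset.univ.image z).erase (z i), (Polynomial.X - C ν), ?_, fun j hj => ?_⟩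
    · rw [Polynomial.eval_prod, Finset.prod_ne_zero_iff]
      intro ν hν
      rw [Polynomial.eval_sub, Polynomial.eval_X, Polynomial.eval_C]
      exact sub_ne_zero.2 (Finset.ne_of_mem_erase hν).symm
    · rw [Polynomial.eval_prod]
      refine Finset.prod_eq_zero (i := z j) (by simp [hj]) (by simp)
  have hsum : ∑ j : {j // z j = z i}, (c j * p.eval (z i)) • w j = 0 := by
    rw [← hpoly p, ← Finset.sum_subtype (Finset.univ.filter fun j => z j = z i) (by simp)
      (fun j => (c j * p.eval (z i)) • w j), Finset.sum_filter]
    refine Finset.sum_congr rfl fun j _ => ?_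
    split_ifs with hj
    · rw [hj]
    · rw [hp j hj, mul_zero, zero_smul]
  have := Fintype.linearIndependent_iff.1 (hwind (z i)) _ hsum ⟨i, rfl⟩
  exact (mul_eq_zero.1 this).resolve_right hp0

/-- As the modal matrix is invertible, the matrix inequality in modal coordinates bounds the
storage function after a transition by the one before it. -/
theorem storage_jump_le {m n q : ℕ} {X : Matrix (Fin n) (Fin q) ℝ[X]} {z : Fin n → ℂ}
    {w : Fin n → Fin q → ℂ} (hV : IsUnit (modalMatrix X z w)) {K : Matrix (Fin n) (Fin n) ℝ}
    {K' : Matrix (Fin m) (Fin m) ℝ} {L : Matrix (Fin m) (Fin n) ℝ}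
    (h : ((modalMatrix X z w)ᴴ * toComplex K * modalMatrix X z w -
      (modalMatrix X z w)ᴴ * (toComplex L)ᵀ * toComplex K' * toComplex L *
        modalMatrix X z w).PosSemidef) (x : Fin n → ℝ) :
    (L *ᵥ x) ⬝ᵥ K' *ᵥ (L *ᵥ x) ≤ x ⬝ᵥ K *ᵥ x := by
  obtain ⟨c, hc⟩ := Matrix.mulVec_surjective_iff_isUnit.2 hV (fun i => (x i : ℂ))
  have h1 := h.dotProduct_mulVec_nonneg c
  have hmul : ∀ {a b : ℕ} (A : Matrix (Fin a) (Fin b) ℝ) (y : Fin b → ℝ),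
      toComplex A *ᵥ (fun i => (y i : ℂ)) = fun i => ((A *ᵥ y) i : ℂ) := fun A y => by
    ext i
    simp [toComplex, Matrix.mulVec, dotProduct]
  have hvec : ∀ {a b : ℕ} (A : Matrix (Fin a) (Fin b) ℝ) (y : Fin a → ℝ),
      (fun i => (y i : ℂ)) ᵥ* toComplex A = fun i => ((y ᵥ* A) i : ℂ) := fun A y => by
    ext i
    simp [toComplex, Matrix.vecMul, dotProduct]
  have hdot : ∀ {a : ℕ} (y y' : Fin a → ℝ),
      (fun i => (y i : ℂ)) ⬝ᵥ (fun i => (y' i : ℂ)) = ((y ⬝ᵥ y' : ℝ) : ℂ) := fun y y' => by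
    simp [dotProduct]
  have hstar : star c ᵥ* (modalMatrix X z w)ᴴ = fun i => (x i : ℂ) := by
    rw [← Matrix.star_mulVec, hc]
    ext i
    simp
  simp only [Matrix.sub_mulVec, dotProduct_sub, ← Matrix.mulVec_mulVec, Matrix.mul_assoc,
    hc] at h1
  rw [Matrix.dotProduct_mulVec, hstar, Matrix.dotProduct_mulVec (star c), hstar,
    Matrix.dotProduct_mulVec _ (toComplex L)ᵀ, Matrix.vecMul_transpose] at h1
  simp only [hmul, hdot] at h1
  rw [← Complex.ofReal_sub, Complex.zero_le_real, sub_nonneg] at h1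
  exact h1

/-! ### Switching signals -/

theorem IsSwitchingSignal.exists_right {N : ℕ} {s : ℝ → Fin N} (hs : IsSwitchingSignal s)
    (t : ℝ) : ∃ b > t, ∀ τ ∈ Set.Ico t b, s τ = s t := by
  have h := hs.rightContinuous t
  rw [nhds_discrete, tendsto_pure] at h
  obtain ⟨b, hb, hsub⟩ := mem_nhdsGE_iff_exists_Ico_subset.1 h
  exact ⟨b, hb, hsub⟩

theorem exists_left_of_tendsto {N : ℕ} {s : ℝ → Fin N} {t : ℝ} {k : Fin N}
    (h : Tendsto s (𝓝[<] t) (𝓝 k)) : ∃ a < t, ∀ τ ∈ Set.Ioo a t, s τ = k := by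
  rw [nhds_discrete, tendsto_pure] at h
  obtain ⟨a, ha, hsub⟩ := mem_nhdsLT_iff_exists_Ioo_subset.1 h
  exact ⟨a, ha, hsub⟩

/-- Switching instants do not accumulate, so the signal has a limit from the left everywhere. -/
theorem IsSwitchingSignal.exists_tendsto_left {N : ℕ} {s : ℝ → Fin N} (hs : IsSwitchingSignal s)
    (t : ℝ) : ∃ k, Tendsto s (𝓝[<] t) (𝓝 k) := by
  obtain ⟨a, hat, ha⟩ : ∃ a < t, ∀ τ ∈ Set.Ioo a t, τ ∉ switchingInstants s := by
    have hfin := (hs.locallyFinite (t - 1) t).subset (Set.sdiff_subset (t := {t}))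
    have h1 : ∀ᶠ τ in 𝓝[<] t, τ ∉ (switchingInstants s ∩ Set.Icc (t - 1) t) \ {t} :=
      nhdsWithin_le_nhds (hfin.isClosed.isOpen_compl.mem_nhds (by simp))
    have h2 : ∀ᶠ τ in 𝓝[<] t, τ ∈ Set.Ioo (t - 1) t := Ioo_mem_nhdsLT (by linarith)
    obtain ⟨a, ha, hsub⟩ := mem_nhdsLT_iff_exists_Ioo_subset.1 (h1.and h2)
    refine ⟨a, ha, fun τ hτ hmem => ?_⟩
    obtain ⟨h3, h4⟩ := hsub hτ
    exact h3 ⟨⟨hmem, h4.1.le, h4.2.le⟩, h4.2.ne⟩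
  have hcont : ContinuousOn s (Set.Ioo a t) := fun τ hτ => by
    refine ContinuousAt.continuousWithinAt (continuousAt_iff_continuous_left'_right'.2 ⟨?_, ?_⟩)
    · exact not_not.1 (ha τ hτ)
    · exact (hs.rightContinuous τ).mono_left (nhdsWithin_mono _ Set.Ioi_subset_Ici_self)
  have hmid : (a + t) / 2 ∈ Set.Ioo a t := ⟨by linarith, by linarith⟩
  refine ⟨s ((a + t) / 2), ?_⟩
  rw [nhds_discrete, tendsto_pure]
  filter_upwards [Ioo_mem_nhdsLT hat] with τ hτ
  exact isPreconnected_Ioo.constant hcont hτ hmid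

/-- A function that is nonincreasing across every point is nonincreasing: the infimum of the points
to the right of `a` with a value above `U a` contradicts the local hypotheses. No continuity is
assumed, so that downward jumps are allowed. -/
theorem antitone_of_eventually {U : ℝ → ℝ} (hr : ∀ t, ∃ b > t, ∀ τ ∈ Set.Ioo t b, U τ ≤ U t)
    (hl : ∀ t, ∃ a < t, ∀ τ ∈ Set.Ioo a t, U t ≤ U τ) : Antitone U := by
  intro a b hab
  by_contra hlt
  rw [not_le] at hlt
  set B := {τ | a ≤ τ ∧ U a < U τ} with hB
  have hne : B.Nonempty := ⟨b, hab, hlt⟩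
  have hbdd : BddBelow B := ⟨a, fun τ hτ => hτ.1⟩
  set c := sInf B with hc
  have hac : a ≤ c := le_csInf hne fun τ hτ => hτ.1
  have hgood : ∀ τ, a ≤ τ → τ < c → U τ ≤ U a := fun τ h1 h2 =>
    not_lt.1 fun h3 => absurd (csInf_le hbdd ⟨h1, h3⟩) (not_le.2 h2)
  have hUc : U c ≤ U a := by
    rcases hac.eq_or_lt with h | h
    · rw [← h]
    · obtain ⟨e, he, hle⟩ := hl c
      obtain ⟨τ, h1, h2⟩ := exists_between (max_lt he h)
      exact (hle τ ⟨(le_max_left _ _).trans_lt h1, h2⟩).trans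
        (hgood τ ((le_max_right _ _).trans h1.le) h2)
  obtain ⟨e, he, hle⟩ := hr c
  obtain ⟨τ, hτ, hτe⟩ := exists_lt_of_csInf_lt hne he
  rcases (csInf_le hbdd hτ).eq_or_lt with h | h
  · rw [← hc] at h
    exact absurd hτ.2 (not_lt.2 (h ▸ hUc))
  · exact absurd hτ.2 (not_lt.2 ((hle τ ⟨h, hτe⟩).trans hUc))

/-! ### Transitions between modes -/

/-- The derivatives of `w` at `t` itself carry no information when `w` jumps there; the one-sided
limit is computed with a smooth `v` that coincides with `w` before `t`. -/
theorem tendsto_polyDiff_left {g q : ℕ} (G : Matrix (Fin g) (Fin q) ℝ[X]) {w v : ℝ → Fin q → ℝ}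
    (hv : ContDiff ℝ ∞ v) {a t : ℝ} (hat : a < t) (h : Set.EqOn w v (Set.Ioo a t)) :
    Tendsto (polyDiff G w) (𝓝[<] t) (𝓝 (polyDiff G v t)) := by
  refine ((hasDerivAt_polyDiff hv G t).continuousAt.tendsto.mono_left
    nhdsWithin_le_nhds).congr' ?_
  filter_upwards [Ioo_mem_nhdsLT hat] with τ hτ
  exact (polyDiff_congr G (h.eventuallyEq_of_mem (isOpen_Ioo.mem_nhds hτ))).symm

theorem tendsto_polyDiff_right {g q : ℕ} (G : Matrix (Fin g) (Fin q) ℝ[X]) {w v : ℝ → Fin q → ℝ}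
    (hv : ContDiff ℝ ∞ v) {t b : ℝ} (htb : t < b) (h : Set.EqOn w v (Set.Ioo t b)) :
    Tendsto (polyDiff G w) (𝓝[>] t) (𝓝 (polyDiff G v t)) := by
  refine ((hasDerivAt_polyDiff hv G t).continuousAt.tendsto.mono_left
    nhdsWithin_le_nhds).congr' ?_
  filter_upwards [Ioo_mem_nhdsGT htb] with τ hτ
  exact (polyDiff_congr G (h.eventuallyEq_of_mem (isOpen_Ioo.mem_nhds hτ))).symm

theorem tendsto_qdf {n q : ℕ} {X : Matrix (Fin n) (Fin q) ℝ[X]} (K : Matrix (Fin n) (Fin n) ℝ)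
    {w : ℝ → Fin q → ℝ} {l : Filter ℝ} {x : Fin n → ℝ} (h : Tendsto (polyDiff X w) l (𝓝 x)) :
    Tendsto (qdf (quadraticForm X K) w) l (𝓝 (x ⬝ᵥ K *ᵥ x)) := by
  have hcont : Continuous fun x : Fin n → ℝ => x ⬝ᵥ K *ᵥ x :=
    continuous_id.dotProduct (continuous_const.matrix_mulVec continuous_id)
  rw [funext (qdf_quadraticForm X K w)]
  exact (hcont.tendsto x).comp h

/-- The gluing conditions in normal form determine the state after a transition. -/
theorem state_after_transition {N q : ℕ} {S : SLDS N q}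
    {R : Fin N → Matrix (Fin q) (Fin q) ℝ[X]} {n : Fin N → ℕ}
    {X : ∀ k, Matrix (Fin (n k)) (Fin q) ℝ[X]}
    {Fm : ∀ k l, Matrix (Fin (S.gluingRows k l)) (Fin (n k)) ℝ}
    {Fp : ∀ k l, Matrix (Fin (S.gluingRows k l)) (Fin (n l)) ℝ}
    (hnormal : IsNormalForm S R X Fm Fp) {k l : Fin N} (hkl : k ≠ l)
    {L : Matrix (Fin (n l)) (Fin (n k)) ℝ} (hL : IsReinitialisationMap (Fm k l) (Fp k l) L)
    {u v w : ℝ → Fin q → ℝ} (hv : v ∈ kerBehaviour (R k)) (hu : u ∈ kerBehaviour (R l))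
    {a t b : ℝ} (hat : a < t) (htb : t < b) (hwv : Set.EqOn w v (Set.Ioo a t))
    (hwu : Set.EqOn w u (Set.Ioo t b)) {c : Fin (S.gluingRows k l) → ℝ}
    (hcp : Tendsto (polyDiff (S.gluingPlus k l) w) (𝓝[>] t) (𝓝 c))
    (hcm : Tendsto (polyDiff (S.gluingMinus k l) w) (𝓝[<] t) (𝓝 c)) :
    polyDiff (X l) u t = L *ᵥ polyDiff (X k) v t := by
  obtain ⟨⟨-, Pm, hm⟩, ⟨-, Pp, hp⟩⟩ := hnormal k l hkl
  have h1 := tendsto_nhds_unique hcp (tendsto_polyDiff_right _ hu.1 htb hwu)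
  have h2 := tendsto_nhds_unique hcm (tendsto_polyDiff_left _ hv.1 hat hwv)
  rw [polyDiff_eq_mulVec hp hu] at h1
  rw [polyDiff_eq_mulVec hm hv] at h2
  obtain ⟨M, hM, rfl⟩ := hL
  rw [← Matrix.mulVec_mulVec, ← h2, h1, Matrix.mulVec_mulVec, hM, Matrix.one_mulVec]

/-- If a trajectory of the switched system coincides with `v` just before a transition and with `u`
just after it, then the storage function of the new mode at `u` is at most that of the old mode
at `v`. -/
theorem storage_le_of_transition {N q : ℕ} {S : SLDS N q}
    {R : Fin N → Matrix (Fin q) (Fin q) ℝ[X]} (hmode : ∀ k, S.mode k = kerBehaviour (R k))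
    {n : Fin N → ℕ} {X : ∀ k, Matrix (Fin (n k)) (Fin q) ℝ[X]}
    {Fm : ∀ k l, Matrix (Fin (S.gluingRows k l)) (Fin (n k)) ℝ}
    {Fp : ∀ k l, Matrix (Fin (S.gluingRows k l)) (Fin (n l)) ℝ}
    (hnormal : IsNormalForm S R X Fm Fp) {L : ∀ k l, Matrix (Fin (n l)) (Fin (n k)) ℝ}
    (hL : ∀ k l, k ≠ l → IsReinitialisationMap (Fm k l) (Fp k l) (L k l))
    {K : ∀ k, Matrix (Fin (n k)) (Fin (n k)) ℝ}
    (hjump : ∀ k l, k ≠ l → ∀ x, (L k l *ᵥ x) ⬝ᵥ K l *ᵥ (L k l *ᵥ x) ≤ x ⬝ᵥ K k *ᵥ x)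
    {s : ℝ → Fin N} {w : ℝ → Fin q → ℝ} (hw : w ∈ S.signalBehaviour s) {t : ℝ}
    (ht : t ∈ switchingInstants s) {k : Fin N} (hk : Tendsto s (𝓝[<] t) (𝓝 k))
    {u v : ℝ → Fin q → ℝ} (hv : v ∈ S.mode k) (hu : u ∈ S.mode (s t))
    {a b : ℝ} (hat : a < t) (htb : t < b) (hwv : Set.EqOn w v (Set.Ioo a t))
    (hwu : Set.EqOn w u (Set.Ioo t b)) :
    polyDiff (X (s t)) u t ⬝ᵥ K (s t) *ᵥ polyDiff (X (s t)) u t ≤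
      polyDiff (X k) v t ⬝ᵥ K k *ᵥ polyDiff (X k) v t := by
  have hkl : k ≠ s t := by
    rintro rfl
    exact ht hk
  obtain ⟨c, hcp, hcm⟩ := hw.2 t ht k hk
  rw [hmode] at hv hu
  rw [state_after_transition hnormal hkl (hL k _ hkl) hv hu hat htb hwv hwu hcp hcm]
  exact hjump k _ hkl _

/-- For a suitable rate `α`, the function `exp (α t) V(t)`, with `V` the storage function of the
active mode, is nonincreasing within the modes and at the transitions, hence throughout. -/
theorem asymptoticallyStable_behaviour {N q : ℕ} {S : SLDS N q}
    {R : Fin N → Matrix (Fin q) (Fin q) ℝ[X]} (hmode : ∀ k, S.mode k = kerBehaviour (R k))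
    {n : Fin N → ℕ} {X : ∀ k, Matrix (Fin (n k)) (Fin q) ℝ[X]}
    {Fm : ∀ k l, Matrix (Fin (S.gluingRows k l)) (Fin (n k)) ℝ}
    {Fp : ∀ k l, Matrix (Fin (S.gluingRows k l)) (Fin (n l)) ℝ}
    (hnormal : IsNormalForm S R X Fm Fp) {L : ∀ k l, Matrix (Fin (n l)) (Fin (n k)) ℝ}
    (hL : ∀ k l, k ≠ l → IsReinitialisationMap (Fm k l) (Fp k l) (L k l))
    {K F : ∀ k, Matrix (Fin (n k)) (Fin (n k)) ℝ}
    (hjump : ∀ k l, k ≠ l → ∀ x, (L k l *ᵥ x) ⬝ᵥ K l *ᵥ (L k l *ᵥ x) ≤ x ⬝ᵥ K k *ᵥ x)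
    (hstorage : ∀ k, IsStrictStorage (R k) (X k) (K k) (F k)) :
    AsymptoticallyStable S.behaviour := by
  rintro w ⟨s, hs, hw⟩
  choose M hM hbound using fun k => (hstorage k).exists_bound
  have hMle : ∀ k, M k ≤ 1 + ∑ l, M l := fun k => by
    have := Finset.single_le_sum (f := M) (fun l _ => (hM l).le) (Finset.mem_univ k)
    linarith
  obtain ⟨C, hC0, hC⟩ : ∃ C : ℝ, 0 < C ∧ ∀ k, M k ≤ C :=
    ⟨1 + ∑ l, M l, by have := Finset.sum_nonneg fun l (_ : l ∈ Finset.univ) => (hM l).le; linarith,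
      hMle⟩
  -- One trajectory is chosen for each mode and interval, so that the choices at two instants of
  -- the same interval coincide.
  have hex : ∀ (k : Fin N) (I : Set ℝ), ∃ v, I.OrdConnected → (∀ t ∈ I, s t = k) →
      v ∈ S.mode k ∧ Set.EqOn w v I := fun k I => by
    by_cases h : I.OrdConnected ∧ ∀ t ∈ I, s t = k
    · obtain ⟨v, hv⟩ := hw.1 k I h.1 h.2
      exact ⟨v, fun _ _ => hv⟩
    · exact ⟨0, fun h1 h2 => absurd ⟨h1, h2⟩ h⟩
  choose piece hpiece using hex
  set traj : ℝ → ℝ → Fin q → ℝ := fun t =>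
    piece (s t) (Set.ordConnectedComponent (s ⁻¹' {s t}) t) with htraj
  have htraj_spec : ∀ t, traj t ∈ S.mode (s t) ∧
      Set.EqOn w (traj t) (Set.ordConnectedComponent (s ⁻¹' {s t}) t) := fun t =>
    hpiece _ _ inferInstance fun τ hτ =>
      Set.ordConnectedComponent_subset (s := s ⁻¹' {s t}) hτ
  have htraj_eq : ∀ {k t τ}, s t = k → s τ = k → (∀ σ ∈ Set.uIcc t τ, s σ = k) →
      traj t = traj τ := fun {k t τ} h1 h2 h => by
    simp only [htraj]
    rw [h1, h2, Set.ordConnectedComponent_eq (s := s ⁻¹' {k}) (fun σ hσ => h σ hσ)]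
  -- The storage function of the active mode is evaluated on the chosen smooth trajectory, since the
  -- derivatives of `w` itself at a switching instant are not meaningful.
  set V : ℝ → ℝ := fun t => polyDiff (X (s t)) (traj t) t ⬝ᵥ
    K (s t) *ᵥ polyDiff (X (s t)) (traj t) t with hV
  have hV_eq : ∀ {k t τ}, s t = k → s τ = k → (∀ σ ∈ Set.uIcc t τ, s σ = k) →
      V τ = polyDiff (X k) (traj t) τ ⬝ᵥ K k *ᵥ polyDiff (X k) (traj t) τ :=
    fun {k t τ} h1 h2 h => by
      simp only [hV]
      rw [← htraj_eq h1 h2 h]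
      subst h2
      rfl
  have hV0 : ∀ t, 0 ≤ V t := fun t =>
    (hstorage (s t)).nonneg (by rw [← hmode]; exact (htraj_spec t).1) t
  have hmodeAnti : ∀ k, ∀ v ∈ S.mode k, Antitone fun t =>
      Real.exp (C⁻¹ * t) * (polyDiff (X k) v t ⬝ᵥ K k *ᵥ polyDiff (X k) v t) := fun k v hv => by
    rw [hmode] at hv
    refine (hstorage k).antitone_exp_mul hv fun t => ?_
    rw [inv_mul_le_iff₀ hC0]
    refine ((hbound k v hv t).2).trans (mul_le_mul_of_nonneg_right (hC k) ?_)
    exact neg_nonneg.2 ((hstorage k).dotProduct_nonpos _)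
  have hanti : Antitone fun t => Real.exp (C⁻¹ * t) * V t := by
    refine antitone_of_eventually (fun t => ?_) fun t => ?_
    · obtain ⟨b, hb, hsb⟩ := hs.exists_right t
      refine ⟨b, hb, fun τ hτ => ?_⟩
      have h1 : ∀ σ ∈ Set.uIcc t τ, s σ = s t := fun σ hσ => by
        rw [Set.uIcc_of_le hτ.1.le] at hσ
        exact hsb σ ⟨hσ.1, hσ.2.trans_lt hτ.2⟩
      rw [hV_eq rfl (h1 τ Set.right_mem_uIcc) h1]
      exact hmodeAnti _ _ (htraj_spec t).1 hτ.1.le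
    · obtain ⟨k, hk⟩ := hs.exists_tendsto_left t
      obtain ⟨a, hat, hsa⟩ := exists_left_of_tendsto hk
      refine ⟨a, hat, fun τ hτ => ?_⟩
      have hτk := hsa τ hτ
      have hτmode : traj τ ∈ S.mode k := hτk ▸ (htraj_spec τ).1
      have hle := hmodeAnti k _ hτmode hτ.2.le
      have hVτ : V τ = polyDiff (X k) (traj τ) τ ⬝ᵥ K k *ᵥ polyDiff (X k) (traj τ) τ :=
        hV_eq hτk hτk fun σ hσ => by rw [Set.uIcc_self] at hσ; rw [hσ, hτk]
      rw [hVτ]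
      refine le_trans (mul_le_mul_of_nonneg_left ?_ (Real.exp_pos _).le) hle
      by_cases ht : t ∈ switchingInstants s
      · obtain ⟨b, hb, hsb⟩ := hs.exists_right t
        refine storage_le_of_transition hmode hnormal hL hjump hw ht hk hτmode
          (htraj_spec t).1 hat hb (fun σ hσ => (htraj_spec τ).2 ?_)
          fun σ hσ => (htraj_spec t).2 ?_
        · intro ρ hρ
          exact (hsa ρ (Set.ordConnected_Ioo.uIcc_subset hτ hσ hρ)).trans hτk.symm
        · intro ρ hρ
          exact hsb ρ (Set.ordConnected_Ico.uIcc_subset ⟨le_rfl, hb⟩ ⟨hσ.1.le, hσ.2⟩ hρ)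
      · have hst : s t = k := tendsto_nhds_unique (not_not.1 ht) hk
        refine (hV_eq hτk hst fun σ hσ => ?_).le
        rw [Set.uIcc_of_le hτ.2.le] at hσ
        rcases hσ.2.eq_or_lt with h | h
        · rw [h, hst]
        · exact hsa σ ⟨hτ.1.trans_le hσ.1, h⟩
  have hwV : ∀ t i, w t i ^ 2 ≤ C * V t := fun t i => by
    have h1 := (htraj_spec t).2 (Set.self_mem_ordConnectedComponent.2 rfl)
    have h2 := (hbound (s t) (traj t) (by rw [← hmode]; exact (htraj_spec t).1) t).1 i
    rw [h1]
    exact h2.trans (mul_le_mul_of_nonneg_right (hC _) (hV0 t))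
  have hdecay : ∀ t, 0 ≤ t → V t ≤ Real.exp (-(C⁻¹ * t)) * V 0 := fun t ht => by
    have := hanti ht
    simp only [mul_zero, Real.exp_zero, one_mul] at this
    rw [Real.exp_neg, ← div_eq_inv_mul, le_div_iff₀ (Real.exp_pos _), mul_comm]
    exact this
  have hlim : Tendsto (fun t => C * (Real.exp (-(C⁻¹ * t)) * V 0)) atTop (𝓝 0) := by
    have h1 : Tendsto (fun t => Real.exp (-(C⁻¹ * t))) atTop (𝓝 0) :=
      Real.tendsto_exp_neg_atTop_nhds_zero.comp
        (tendsto_id.const_mul_atTop (inv_pos.2 hC0))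
    simpa using (h1.mul_const (V 0)).const_mul C
  rw [tendsto_pi_nhds]
  intro i
  have hsq : Tendsto (fun t => w t i ^ 2) atTop (𝓝 0) := by
    refine tendsto_of_tendsto_of_tendsto_of_le_of_le' tendsto_const_nhds hlim
      (Eventually.of_forall fun t => sq_nonneg _) ?_
    filter_upwards [eventually_ge_atTop 0] with t ht
    exact (hwV t i).trans (mul_le_mul_of_nonneg_left (hdecay t ht) hC0.le)
  have hsqrt := hsq.sqrt
  simp only [Real.sqrt_sq_eq_abs, Real.sqrt_zero] at hsqrt
  exact (tendsto_zero_iff_abs_tendsto_zero _).2 hsqrt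

theorem isMultipleLyapunovFunction_of_isStrictStorage {N q : ℕ} {S : SLDS N q}
    {R : Fin N → Matrix (Fin q) (Fin q) ℝ[X]} (hmode : ∀ k, S.mode k = kerBehaviour (R k))
    {n : Fin N → ℕ} {X : ∀ k, Matrix (Fin (n k)) (Fin q) ℝ[X]}
    {Fm : ∀ k l, Matrix (Fin (S.gluingRows k l)) (Fin (n k)) ℝ}
    {Fp : ∀ k l, Matrix (Fin (S.gluingRows k l)) (Fin (n l)) ℝ}
    (hnormal : IsNormalForm S R X Fm Fp) {L : ∀ k l, Matrix (Fin (n l)) (Fin (n k)) ℝ}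
    (hL : ∀ k l, k ≠ l → IsReinitialisationMap (Fm k l) (Fp k l) (L k l))
    {K F : ∀ k, Matrix (Fin (n k)) (Fin (n k)) ℝ}
    (hjump : ∀ k l, k ≠ l → ∀ x, (L k l *ᵥ x) ⬝ᵥ K l *ᵥ (L k l *ᵥ x) ≤ x ⬝ᵥ K k *ᵥ x)
    (hstorage : ∀ k, IsStrictStorage (R k) (X k) (K k) (F k)) :
    IsMultipleLyapunovFunction S (fun k => quadraticForm (X k) (K k)) where
  nonneg k w hw t := by
    rw [hmode] at hw
    rw [qdf_quadraticForm]
    exact (hstorage k).nonneg hw t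
  deriv_neg k := by
    have hderiv : ∀ w ∈ S.mode k, ∀ t, deriv (qdf (quadraticForm (X k) (K k)) w) t =
        polyDiff (X k) w t ⬝ᵥ F k *ᵥ polyDiff (X k) w t := fun w hw t => by
      rw [funext (qdf_quadraticForm (X k) (K k) w)]
      rw [hmode] at hw
      exact ((hstorage k).hasDerivAt w hw t).deriv
    refine ⟨fun w hw t => ?_, fun w hw h => ?_⟩
    · refine (hderiv w hw t).le.trans ?_
      exact (hstorage k).dotProduct_nonpos _
    · obtain ⟨C, hC⟩ := (hstorage k).observable
      ext1 t
      have hx : polyDiff (X k) w t = 0 := by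
        by_contra hx
        exact ((hstorage k).dotProduct_neg hx).ne ((hderiv w hw t).symm.trans (h t))
      rw [hmode] at hw
      rw [hC w hw t, hx, Matrix.mulVec_zero, Pi.zero_apply]
  jump s hs w hw t ht k hk := by
    obtain ⟨a, hat, hsa⟩ := exists_left_of_tendsto hk
    obtain ⟨b, htb, hsb⟩ := hs.exists_right t
    obtain ⟨v, hv, hwv⟩ := hw.1 k _ Set.ordConnected_Ioo hsa
    obtain ⟨u, hu, hwu⟩ := hw.1 (s t) _ Set.ordConnected_Ico hsb
    have hwu' := hwu.mono Set.Ioo_subset_Ico_self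
    refine ⟨_, _, tendsto_qdf (K k) (tendsto_polyDiff_left (X k) ?_ hat hwv),
      tendsto_qdf (K (s t)) (tendsto_polyDiff_right (X (s t)) ?_ htb hwu'),
      storage_le_of_transition hmode hnormal hL hjump hw ht hk hv hu hat htb hwv hwu'⟩
    · rw [hmode] at hv; exact hv.1
    · rw [hmode] at hu; exact hu.1

end SwitchedLDS

/-! ### The multiple Lyapunov function of the switched system -/

theorem mainTheorem2 {N q : ℕ} (S : SwitchedLDS.SLDS N q)
    -- the modes: kernel representations, nonsingular and asymptotically stable
    (R : Fin N → Matrix (Fin q) (Fin q) (Polynomial ℝ))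
    (hR : ∀ k, (R k).det ≠ 0)
    (hmode : ∀ k, S.mode k = SwitchedLDS.kerBehaviour (R k))
    (hstable : ∀ k, SwitchedLDS.AsymptoticallyStable (S.mode k))
    -- `n_k = deg det R_k`, and the minimal state maps
    (n : Fin N → ℕ) (hn : ∀ k, n k = (R k).det.natDegree)
    (X : ∀ k, Matrix (Fin (n k)) (Fin q) (Polynomial ℝ))
    (hX : ∀ k, SwitchedLDS.IsMinimalStateMap (R k) (X k))
    -- `R_k` has degree at most `d_k`
    (d : Fin N → ℕ) (hd : ∀ k i j, (R k i j).natDegree ≤ d k)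
    -- the roots of `det R_k`, listed with multiplicity, are semisimple, with eigenvectors `w_{k,i}`
    (z : ∀ k, Fin (n k) → ℂ)
    (hz : ∀ k, Finset.univ.val.map (z k) = (R k).det.aroots ℂ)
    (hsemi : ∀ k i, ((R k).det.map (algebraMap ℝ ℂ)).rootMultiplicity (z k i) =
      Module.finrank ℂ (LinearMap.ker (SwitchedLDS.evalAt (R k) (z k i)).mulVecLin))
    (w : ∀ k, Fin (n k) → Fin q → ℂ)
    (hw : ∀ k i, (SwitchedLDS.evalAt (R k) (z k i)) *ᵥ (w k i) = 0)
    (hwind : ∀ k (μ : ℂ), LinearIndependent ℂ (fun i : {i // z k i = μ} => w k i))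
    -- normal form of the gluing conditions, well-posedness, re-initialisation maps
    (Fm : ∀ k l, Matrix (Fin (S.gluingRows k l)) (Fin (n k)) ℝ)
    (Fp : ∀ k l, Matrix (Fin (S.gluingRows k l)) (Fin (n l)) ℝ)
    (hnormal : SwitchedLDS.IsNormalForm S R X Fm Fp)
    (hwell : SwitchedLDS.IsWellPosed Fm Fp)
    (L : ∀ k l, Matrix (Fin (n l)) (Fin (n k)) ℝ)
    (hL : ∀ k l, k ≠ l → SwitchedLDS.IsReinitialisationMap (Fm k l) (Fp k l) (L k l))
    -- the structured linear matrix inequality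
    (K : ∀ k, Matrix (Fin (n k)) (Fin (n k)) ℝ)
    (Y : ∀ k, Matrix (Fin q) (Fin (n k)) ℝ)
    (hLMI : ∀ k, (-SwitchedLDS.lmiMatrix (d k) (R k) (X k) (K k) (Y k)).PosSemidef) :
    (∃ F : ∀ k, Matrix (Fin (n k)) (Fin (n k)) ℝ,
      ∀ k, SwitchedLDS.lmiMatrix (d k) (R k) (X k) (K k) (Y k) =
        (SwitchedLDS.padRight (SwitchedLDS.coeffMatrix (d k) (X k)))ᵀ * F k *
          SwitchedLDS.padRight (SwitchedLDS.coeffMatrix (d k) (X k))) ∧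
    (∀ F : ∀ k, Matrix (Fin (n k)) (Fin (n k)) ℝ,
      (∀ k, SwitchedLDS.lmiMatrix (d k) (R k) (X k) (K k) (Y k) =
        (SwitchedLDS.padRight (SwitchedLDS.coeffMatrix (d k) (X k)))ᵀ * F k *
          SwitchedLDS.padRight (SwitchedLDS.coeffMatrix (d k) (X k))) →
      (∀ k, (-F k).PosDef) →
      (∀ k l, k ≠ l →
        ((SwitchedLDS.modalMatrix (X k) (z k) (w k))ᴴ * SwitchedLDS.toComplex (K k) *
            SwitchedLDS.modalMatrix (X k) (z k) (w k) -
          (SwitchedLDS.modalMatrix (X k) (z k) (w k))ᴴ * (SwitchedLDS.toComplex (L k l))ᵀ *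
            SwitchedLDS.toComplex (K l) * SwitchedLDS.toComplex (L k l) *
            SwitchedLDS.modalMatrix (X k) (z k) (w k)).PosSemidef) →
      SwitchedLDS.AsymptoticallyStable S.behaviour ∧
      SwitchedLDS.IsMultipleLyapunovFunction S
        (fun k => SwitchedLDS.quadraticForm (X k) (K k))) := by
  refine ⟨?_, fun F hF hneg hjump => ?_⟩
  · choose F hF using fun k => SwitchedLDS.exists_lmiMatrix_eq (hR k) (hd k) (hX k) (hLMI k)
    exact ⟨F, hF⟩
  · have hstorage : ∀ k, SwitchedLDS.IsStrictStorage (R k) (X k) (K k) (F k) := fun k =>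
      { stable := hmode k ▸ hstable k
        observable := SwitchedLDS.observable_of_isMinimalStateMap (hR k) (hX k)
        hasDerivAt := fun _ hw t =>
          SwitchedLDS.hasDerivAt_storage (hR k) (hd k) (hX k) (hF k) hw t
        posDef_neg := hneg k }
    have hle : ∀ k l, k ≠ l → ∀ x : Fin (n k) → ℝ,
        (L k l *ᵥ x) ⬝ᵥ K l *ᵥ (L k l *ᵥ x) ≤ x ⬝ᵥ K k *ᵥ x := fun k l hkl =>
      SwitchedLDS.storage_jump_le
        (SwitchedLDS.isUnit_modalMatrix (hR k) (hX k) (hw k) (hwind k)) (hjump k l hkl)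
    exact ⟨SwitchedLDS.asymptoticallyStable_behaviour hmode hnormal hL hle hstorage,
      SwitchedLDS.isMultipleLyapunovFunction_of_isStrictStorage hmode hnormal hL hle hstorage⟩
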